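/- For an integer $m$ put $[m]=\frac{1-q^m}{1-q}$, let $(x;y)_k=\prod_{i=0}^{k-1}(1-xy^i)$, and let $\Phi_n(q)$ be the $n$-th cyclotomic polynomial. For rational functions $A,B\in\mathbb{Q}(q)$ and a polynomial $P\in\mathbb{Q}[q]$, write $A\equiv B\pmod P$ if $A-B=Pu/v$ with $u,v\in\mathbb{Q}[q]$ and $v$ coprime to $P$. Theorem 5.2. Let $r\in\{1,-1\}$ and let $n,d$ be integers such that $n+r\ge d\ge 3$, $\gcd(n,d)=1$ and $n\equiv -r\pmod d$. Put $N=(dn-n-r)/d$, and let $M=N$ or $M=n-1$. Then, modulo $[n]\Phi_n(q)^5$, $$\sum_{k=0}^{M}[2dk+r]\frac{(q^r;q^d)_k^6}{(q^d;q^d)_k^6}\,q^{(2d-3r)k} \equiv [dn-n]\,q^{r(r+n-dn)/d}\,\frac{(q^{2r};q^d)_{N}}{(q^d;q^d)_{N}} \sum_{k=0}^{N}\frac{(q^r;q^d)_k^3\,(q^{d-r};q^d)_k\,q^{dk}}{(q^d;q^d)_k^3\,(q^{2r};q^d)_k} \left\{1-[dn-n]^2\,(2-q^{dn-n})\sum_{j=1}^{k}\left(\frac{q^{dj}}{[dj]^2}+\frac{q^{dj-d+r}}{[dj-d+r]^2}\right)\right\}.$$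 -/

import Mathlib

open Finset

noncomputable section

namespace QSeries

/-- The indeterminate `q`, as an element of the field `ℚ(q)` of rational functions. -/
abbrev q : RatFunc ℚ := RatFunc.X

/-- The `q`-integer `[m] = (1 - q^m) / (1 - q)` for an arbitrary integer `m`. -/
def qInt (m : ℤ) : RatFunc ℚ := (1 - q ^ m) / (1 - q)

/-- The `q`-shifted factorial `(x; y)_k = (1 - x)(1 - x y) ⋯ (1 - x y^(k-1))`. -/
def qPoch (x y : RatFunc ℚ) (k : ℕ) : RatFunc ℚ := ∏ i ∈ range k, (1 - x * y ^ i)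

/-- The `q`-integer `[n] = 1 + q + ⋯ + q^(n-1)` as a polynomial, for a natural number `n`. -/
def qIntPoly (n : ℕ) : Polynomial ℚ := ∑ i ∈ range n, Polynomial.X ^ i

/-- The modulus `[n] Φ_n(q)^5`. -/
def modulus (n : ℕ) : Polynomial ℚ := qIntPoly n * Polynomial.cyclotomic n ℚ ^ 5

/-- Congruence of rational functions modulo a polynomial `P`: the difference is
`P * u / v` with polynomials `u`, `v` such that `v` is coprime to `P`. -/
def RatCongr (P : Polynomial ℚ) (A B : RatFunc ℚ) : Prop :=
  ∃ u v : Polynomial ℚ, IsCoprime v P ∧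
    A - B = algebraMap (Polynomial ℚ) (RatFunc ℚ) (P * u) /
      algebraMap (Polynomial ℚ) (RatFunc ℚ) v

/-- The index `(dn - n - r) / d`; the division is exact and the quotient is nonnegative
in the situation of interest, see `mul_topIndex`. -/
def topIndex (n d : ℕ) (r : ℤ) : ℕ := (((d : ℤ) * n - n - r) / d).toNat

/-- The left-hand side `∑_{k=0}^{M} [2dk+r] (q^r;q^d)_k^6 / (q^d;q^d)_k^6 q^((2d-3r)k)`. -/
def lhsSum (d : ℕ) (r : ℤ) (M : ℕ) : RatFunc ℚ :=
  ∑ k ∈ range (M + 1),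
    qInt (2 * d * k + r) * (qPoch (q ^ r) (q ^ d) k ^ 6 / qPoch (q ^ d) (q ^ d) k ^ 6)
      * q ^ ((2 * (d : ℤ) - 3 * r) * k)

/-- The `q`-harmonic sum `∑_{j=1}^{k} (q^(dj) / [dj]^2 + q^(dj-d+r) / [dj-d+r]^2)`. -/
def innerSum (d : ℕ) (r : ℤ) (k : ℕ) : RatFunc ℚ :=
  ∑ j ∈ Icc 1 k,
    (q ^ ((d : ℤ) * j) / qInt (d * j) ^ 2
      + q ^ ((d : ℤ) * j - d + r) / qInt (d * j - d + r) ^ 2)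

theorem one_sub_q_ne_zero : (1 - q : RatFunc ℚ) ≠ 0 := by
  intro h
  have h1 : algebraMap (Polynomial ℚ) (RatFunc ℚ) (1 - Polynomial.X) = 0 := by
    rw [map_sub, map_one, RatFunc.algebraMap_X]; exact h
  have h2 := RatFunc.algebraMap_injective ℚ (h1.trans (map_zero _).symm)
  have h3 := congrArg (Polynomial.eval 0) h2
  simp at h3

/-- The polynomial `q`-integer agrees with the rational-function one. -/
theorem algebraMap_qIntPoly (n : ℕ) :
    algebraMap (Polynomial ℚ) (RatFunc ℚ) (qIntPoly n) = qInt n := by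
  rw [qInt, eq_div_iff one_sub_q_ne_zero, qIntPoly, map_sum]
  simp only [map_pow, RatFunc.algebraMap_X, zpow_natCast]
  exact geom_sum_mul_neg _ _

theorem mul_topIndex {n d : ℕ} {r : ℤ} (hd : 3 ≤ d) (hnd : (d : ℤ) ≤ n + r) (hr : r = 1 ∨ r = -1)
    (hmod : (n : ℤ) ≡ -r [ZMOD d]) :
    (d : ℤ) * (topIndex n d r : ℤ) = (d : ℤ) * n - n - r := by
  obtain ⟨c, hc⟩ := hmod.dvd
  have hd0 : (0 : ℤ) < d := by exact_mod_cast (by omega : 0 < d)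
  have h1 : (d : ℤ) * n - n - r = d * (n + c) := by linarith
  have h2 : (0 : ℤ) ≤ d * (n + c) := by
    rw [← h1]
    have : (3 : ℤ) ≤ d := by exact_mod_cast hd
    rcases hr with rfl | rfl <;> nlinarith
  have h3 : (0 : ℤ) ≤ n + c := nonneg_of_mul_nonneg_right h2 hd0
  rw [topIndex, h1, Int.mul_ediv_cancel_left _ hd0.ne', Int.toNat_of_nonneg h3]

end QSeries

end

open QSeries

/-!
Put `p = q ^ d`, `a = q ^ r` and `u = a * p ^ N = q ^ (d * n - n)`, so that `u ≡ 1` modulo `Φ_n`.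
Let `W x y z` be the very-well-poised sum over `k ≤ N` with the symmetric pairs of parameters
`a x`, `a / x` and `a y`, `a / y` and the further parameter `a / z`; up to a factor `1 - q` the
left-hand side is `W 1 1 1`.

*Modulo `Φ_n ^ 6`.* The terms with `N < k < n` vanish. The second mixed difference of `W` in the
two pairs gives `W 1 1 1 = 2 * W u 1 1 - W u u 1 + (W u u 1 - W u 1 1 - W 1 u 1 + W 1 1 1)`.
The sums `W u 1 1` and `W u u 1` terminate through `a / u = p ^ (-N)`, so Watson's transformation
turns them into balanced series with coefficients divisible by `Φ_n ^ 2`, and expanding to order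
`(1 - u) ^ 4` yields the right-hand side with its harmonic sums. The mixed difference has two
parts. For `z = u` Watson's transformation applies to all four sums and gives a factor `Φ_n ^ 2`
besides the `(1 - u) ^ 4` of the differences. Changing `z` from `1` to `u` gives a factor
`(1 - u) ^ 5` times a sum which vanishes modulo `Φ_n`, because a very-well-poised series with
`a * p ^ N = 1` is antisymmetric under `k ↦ N - k`.

*Modulo `Φ_m` for the other divisors `m > 1` of `n`.* Both sides vanish: the left one splits into
blocks of length `m` to which the same antisymmetry applies, on the right one counts the factors
`Φ_m`.
-/

namespace QSeries

/-! ### Watson's transformation -/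

section ShiftedFactorial

/-- The `q`-shifted factorial `(a; p)_k = (1 - a) (1 - a p) ⋯ (1 - a p^(k-1))` in an arbitrary
commutative ring; `qPoch` is the case of `ℚ(q)`. -/
def poch {R : Type*} [CommRing R] (a p : R) (k : ℕ) : R := ∏ i ∈ range k, (1 - a * p ^ i)

variable {R : Type*} [CommRing R]

@[simp]
theorem poch_zero (a p : R) : poch a p 0 = 1 := prod_range_zero _

theorem poch_succ (a p : R) (k : ℕ) : poch a p (k + 1) = poch a p k * (1 - a * p ^ k) :=
  prod_range_succ _ _

theorem poch_add (a p : R) (k l : ℕ) :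
    poch a p (k + l) = poch a p k * poch (a * p ^ k) p l := by
  simp only [poch, prod_range_add, pow_add, mul_assoc]

theorem poch_succ' (a p : R) (k : ℕ) : poch a p (k + 1) = (1 - a) * poch (a * p) p k := by
  rw [add_comm, poch_add, pow_one, poch_succ, poch_zero, one_mul, pow_zero, mul_one]

variable [IsDomain R] {a p : R} {k m : ℕ}

theorem poch_ne_zero_iff : poch a p k ≠ 0 ↔ ∀ i < k, 1 - a * p ^ i ≠ 0 := by
  simp only [poch, prod_ne_zero_iff, mem_range]

theorem poch_ne_zero_of_le (h : poch a p m ≠ 0) (hk : k ≤ m) : poch a p k ≠ 0 :=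
  poch_ne_zero_iff.2 fun i hi => poch_ne_zero_iff.1 h i (hi.trans_le hk)

theorem poch_shift_ne_zero {l : ℕ} (h : poch a p m ≠ 0) (hkl : k + l ≤ m) :
    poch (a * p ^ k) p l ≠ 0 :=
  right_ne_zero_of_mul (poch_add a p k l ▸ poch_ne_zero_of_le h hkl)

end ShiftedFactorial

section Watson

variable {K : Type*} [Field K]

/-- The general term, with index `m` in a sum over `m + l = L`, of the terminating
`q`-Pfaff–Saalschütz series with parameters `A`, `B`, `p^(-L)`, arranged symmetrically. -/
def saalschutzTerm (A B X p : K) (m l : ℕ) : K :=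
  poch A p m * poch B p m * X ^ m * poch X p l / (poch p p m * poch p p l * poch (A * B * X) p m)

theorem saalschutzTerm_telescope (A B X : K) {p : K} (hp : p ≠ 0) {m l : ℕ}
    (hpoch : poch p p (m + l + 1) ≠ 0) (hABX : poch (A * B * X) p (m + l + 1) ≠ 0) :
    (1 - p * p ^ (m + l)) * (1 - A * B * X * p ^ (m + l)) * saalschutzTerm A B X p m (l + 1)
      - (1 - A * X * p ^ (m + l)) * (1 - B * X * p ^ (m + l)) * saalschutzTerm A B X p m l
      = p ^ (l + 1) * (1 - p ^ m) * (1 - A * B * X * p ^ m / p) * saalschutzTerm A B X p m (l + 1)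
        - p ^ l * (1 - p * p ^ m) * (1 - A * B * X * p ^ m) *
          saalschutzTerm A B X p (m + 1) l := by
  have hm : poch p p m ≠ 0 := poch_ne_zero_of_le hpoch (by omega)
  have hl : poch p p l ≠ 0 := poch_ne_zero_of_le hpoch (by omega)
  have hABXm : poch (A * B * X) p m ≠ 0 := poch_ne_zero_of_le hABX (by omega)
  have hm' := poch_ne_zero_iff.1 hpoch m (by omega)
  have hl' := poch_ne_zero_iff.1 hpoch l (by omega)
  have hABXm' := poch_ne_zero_iff.1 hABX m (by omega)
  simp only [saalschutzTerm, poch_succ, pow_succ, pow_add]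
  generalize poch p p m = x, poch p p l = y, poch (A * B * X) p m = z, p ^ m = s, p ^ l = t at *
  generalize 1 - A * B * X * s = w at *
  field_simp
  ring

theorem sum_saalschutzTerm_succ (A B X : K) {p : K} (hp : p ≠ 0) {L : ℕ}
    (hpoch : poch p p (L + 1) ≠ 0) (hABX : poch (A * B * X) p (L + 1) ≠ 0) :
    (1 - p * p ^ L) * (1 - A * B * X * p ^ L) *
        ∑ ml ∈ antidiagonal (L + 1), saalschutzTerm A B X p ml.1 ml.2
      = (1 - A * X * p ^ L) * (1 - B * X * p ^ L) *
        ∑ ml ∈ antidiagonal L, saalschutzTerm A B X p ml.1 ml.2 := by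
  let G (m l : ℕ) : K :=
    p ^ l * (1 - p ^ m) * (1 - A * B * X * p ^ m / p) * saalschutzTerm A B X p m l
  have hG (m l : ℕ) : G (m + 1) l =
      p ^ l * (1 - p * p ^ m) * (1 - A * B * X * p ^ m) * saalschutzTerm A B X p (m + 1) l := by
    simp only [G, pow_succ]
    field_simp
  have telescope : ∑ ml ∈ antidiagonal L, (G ml.1 (ml.2 + 1) - G (ml.1 + 1) ml.2)
      = - G (L + 1) 0 := by
    have first := Nat.sum_antidiagonal_succ (n := L) (f := fun ml : ℕ × ℕ => G ml.1 ml.2)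
    have last := Nat.sum_antidiagonal_succ' (n := L) (f := fun ml : ℕ × ℕ => G ml.1 ml.2)
    have hG0 : G 0 (L + 1) = 0 := by simp only [G, pow_zero, sub_self, mul_zero, zero_mul]
    rw [sum_sub_distrib]
    linear_combination first - last + hG0
  have termwise : ∀ ml ∈ antidiagonal L,
      (1 - p * p ^ L) * (1 - A * B * X * p ^ L) * saalschutzTerm A B X p ml.1 (ml.2 + 1)
        - (1 - A * X * p ^ L) * (1 - B * X * p ^ L) * saalschutzTerm A B X p ml.1 ml.2
      = G ml.1 (ml.2 + 1) - G (ml.1 + 1) ml.2 := by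
    rintro ⟨m, l⟩ h
    obtain rfl : m + l = L := mem_antidiagonal.1 h
    rw [hG]
    exact saalschutzTerm_telescope A B X hp hpoch hABX
  rw [← sum_congr rfl termwise, sum_sub_distrib, ← mul_sum, ← mul_sum, hG, pow_zero] at telescope
  rw [Nat.sum_antidiagonal_succ']
  linear_combination telescope

theorem sum_saalschutzTerm (A B X : K) {p : K} (hp : p ≠ 0) {L : ℕ}
    (hpoch : poch p p L ≠ 0) (hABX : poch (A * B * X) p L ≠ 0) :
    ∑ ml ∈ antidiagonal L, saalschutzTerm A B X p ml.1 ml.2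
      = poch (A * X) p L * poch (B * X) p L / (poch p p L * poch (A * B * X) p L) := by
  induction L with
  | zero => simp [saalschutzTerm]
  | succ L ih =>
    have ih := ih (poch_ne_zero_of_le hpoch L.le_succ) (poch_ne_zero_of_le hABX L.le_succ)
    have hrec := sum_saalschutzTerm_succ A B X hp hpoch hABX
    rw [poch_succ, mul_ne_zero_iff] at hpoch hABX
    rw [ih] at hrec
    apply mul_left_cancel₀ (mul_ne_zero hpoch.2 hABX.2)
    rw [hrec, poch_succ, poch_succ, poch_succ, poch_succ]
    obtain ⟨hpochL, hpoch'⟩ := hpoch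
    obtain ⟨hABXL, hABX'⟩ := hABX
    generalize poch p p L = x, poch (A * B * X) p L = y, 1 - p * p ^ L = u,
      1 - A * B * X * p ^ L = w at *
    field_simp

/-- `(α, β)` is a Bailey pair relative to `a`, up to index `N`. -/
def IsBaileyPair (a p : K) (N : ℕ) (α β : ℕ → K) : Prop :=
  ∀ n ≤ N, β n = ∑ r ∈ range (n + 1), α r / (poch p p (n - r) * poch (a * p) p (n + r))

theorem bailey_inner_sum {a p ρ σ X : K} (hX : ρ * σ * X = a * p) (hp : p ≠ 0) {r L : ℕ}
    (hpoch : poch p p (r + L) ≠ 0) (hap : poch (a * p) p (2 * (r + L)) ≠ 0)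
    (hρ : poch (ρ * X) p (r + L) ≠ 0) (hσ : poch (σ * X) p (r + L) ≠ 0) :
    ∑ m ∈ range (L + 1), poch ρ p (r + m) * poch σ p (r + m) * X ^ (r + m) * poch X p (L - m) /
        (poch p p (L - m) * poch p p m * poch (a * p) p (r + m + r))
      = poch (ρ * X) p (r + L) * poch (σ * X) p (r + L) *
        (poch ρ p r * poch σ p r * X ^ r / (poch (ρ * X) p r * poch (σ * X) p r) /
          (poch p p L * poch (a * p) p (r + L + r))) := by
  have hC : ρ * p ^ r * (σ * p ^ r) * X = a * p * p ^ (r + r) := by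
    rw [pow_add]; linear_combination (p ^ r * p ^ r) * hX
  have hpochL : poch p p L ≠ 0 := poch_ne_zero_of_le hpoch (by omega)
  have hshift : poch (a * p * p ^ (r + r)) p L ≠ 0 := poch_shift_ne_zero hap (by omega)
  have happ : poch (a * p) p (r + r) ≠ 0 := poch_ne_zero_of_le hap (by omega)
  have hρr : poch (ρ * X) p r ≠ 0 := poch_ne_zero_of_le hρ (by omega)
  have hσr : poch (σ * X) p r ≠ 0 := poch_ne_zero_of_le hσ (by omega)
  have hsaal := sum_saalschutzTerm (ρ * p ^ r) (σ * p ^ r) X hp hpochL (by rwa [hC])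
  rw [Nat.sum_antidiagonal_eq_sum_range_succ (saalschutzTerm (ρ * p ^ r) (σ * p ^ r) X p)] at hsaal
  calc
    _ = ∑ m ∈ range (L + 1), poch ρ p r * poch σ p r * X ^ r / poch (a * p) p (r + r) *
        saalschutzTerm (ρ * p ^ r) (σ * p ^ r) X p m (L - m) := by
      refine sum_congr rfl fun m _ => ?_
      rw [saalschutzTerm, hC, add_right_comm r m r, poch_add ρ, poch_add σ, poch_add (a * p),
        pow_add]
      simp only [div_eq_mul_inv, mul_inv]
      ring
    _ = _ := by
      rw [← mul_sum, hsaal, hC, add_right_comm r L r, poch_add (ρ * X), poch_add (σ * X),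
        poch_add (a * p) p (r + r), mul_right_comm ρ, mul_right_comm σ]
      generalize poch (ρ * X) p r = x, poch (σ * X) p r = y at *
      field_simp

/-- The terminating form of Bailey's lemma. -/
theorem IsBaileyPair.sum_eq {a p : K} {N : ℕ} {α β : ℕ → K} (hαβ : IsBaileyPair a p N α β)
    {ρ σ X : K} (hX : ρ * σ * X = a * p) (hp : p ≠ 0)
    (hpoch : poch p p N ≠ 0) (hap : poch (a * p) p (2 * N) ≠ 0)
    (hρ : poch (ρ * X) p N ≠ 0) (hσ : poch (σ * X) p N ≠ 0) :
    ∑ n ∈ range (N + 1), poch ρ p n * poch σ p n * X ^ n * poch X p (N - n) / poch p p (N - n) * β n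
      = poch (ρ * X) p N * poch (σ * X) p N *
        ∑ r ∈ range (N + 1), poch ρ p r * poch σ p r * X ^ r * α r /
          (poch (ρ * X) p r * poch (σ * X) p r) / (poch p p (N - r) * poch (a * p) p (N + r)) := by
  have expand : ∀ n ∈ range (N + 1),
      poch ρ p n * poch σ p n * X ^ n * poch X p (N - n) / poch p p (N - n) * β n =
        ∑ r ∈ range (n + 1), poch ρ p n * poch σ p n * X ^ n * poch X p (N - n) /
          poch p p (N - n) * (α r / (poch p p (n - r) * poch (a * p) p (n + r))) := by
    intro n hn
    rw [hαβ n (mem_range_succ_iff.1 hn), mul_sum]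
  rw [sum_congr rfl expand, mul_sum, sum_comm' (t' := range (N + 1)) (s' := fun r => Ico r (N + 1))
    (by intro x y; simp only [mem_range, mem_Ico]; omega)]
  refine sum_congr rfl fun r hr => ?_
  obtain ⟨L, rfl⟩ := Nat.exists_eq_add_of_le (mem_range_succ_iff.1 hr)
  rw [sum_Ico_eq_sum_range, add_assoc r L 1, Nat.add_sub_cancel_left, Nat.add_sub_cancel_left]
  calc
    _ = α r * ∑ m ∈ range (L + 1), poch ρ p (r + m) * poch σ p (r + m) * X ^ (r + m) *
        poch X p (L - m) / (poch p p (L - m) * poch p p m * poch (a * p) p (r + m + r)) := by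
      rw [mul_sum]
      refine sum_congr rfl fun m _ => ?_
      rw [Nat.add_sub_add_left, Nat.add_sub_cancel_left]
      simp only [div_eq_mul_inv, mul_inv]
      ring
    _ = _ := by
      rw [bailey_inner_sum hX hp hpoch hap hρ hσ]
      ring

/-- The `α`-sequence of the unit Bailey pair. -/
def unitAlpha (a p : K) (r : ℕ) : K :=
  (1 - a * p ^ (2 * r)) / (1 - a) * poch a p r / poch p p r * ((-1) ^ r * p ^ r.choose 2)

theorem unitAlpha_succ {a : K} (p : K) (ha : 1 - a ≠ 0) (r : ℕ) :
    unitAlpha a p (r + 1) = (1 - a * p ^ (2 * (r + 1))) * poch (a * p) p r / poch p p (r + 1) *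
      ((-1) ^ (r + 1) * p ^ (r + 1).choose 2) := by
  rw [unitAlpha, poch_succ' a]
  field_simp

theorem sum_range_unitAlpha {a p : K} (ha : 1 - a ≠ 0) (R : ℕ) : ∀ {l : ℕ},
    poch p p (R + l + 1) ≠ 0 → poch (a * p) p (2 * (R + l + 1)) ≠ 0 →
    ∑ r ∈ range (R + 1),
        unitAlpha a p r / (poch p p (R + l + 1 - r) * poch (a * p) p (R + l + 1 + r))
      = (-1) ^ R * p ^ (R + 1).choose 2 * poch (a * p) p R /
        (poch p p R * poch p p l * poch (a * p) p (R + l + 1 + R) * (1 - p * p ^ (R + l))) := by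
  induction R with
  | zero =>
    intro l _ _
    simp [unitAlpha, poch_succ, div_self ha]
    ring
  | succ R ih =>
    intro l hpoch hap
    have hR := poch_ne_zero_of_le hpoch (show R ≤ _ by omega)
    have hl := poch_ne_zero_of_le hpoch (show l ≤ _ by omega)
    have hap' := poch_ne_zero_of_le hap (show R + 1 + l + 1 + R ≤ _ by omega)
    have hR' := poch_ne_zero_iff.1 hpoch R (by omega)
    have hl' := poch_ne_zero_iff.1 hpoch l (by omega)
    have htop := poch_ne_zero_iff.1 hpoch (R + 1 + l) (by omega)
    have haptop := poch_ne_zero_iff.1 hap (R + 1 + l + 1 + R) (by omega)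
    have hsplit : R + 1 + l = R + (l + 1) := by omega
    rw [hsplit] at hpoch hap
    rw [sum_range_succ, hsplit, ih hpoch hap, ← hsplit, unitAlpha_succ p ha,
      show R + 1 + l + 1 - (R + 1) = l + 1 by omega, ← add_assoc _ R 1, poch_succ _ p (_ + R),
      poch_succ (a * p) p R, poch_succ p p l, poch_succ p p R,
      show (R + 1 + 1).choose 2 = (R + 1).choose 2 + (R + 1) by
        rw [Nat.choose_succ_succ' (R + 1) 1, Nat.choose_one_right, add_comm],
      show p ^ (2 * (R + 1)) = p * p ^ R * (p * p ^ R) by ring]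
    rw [show p * p ^ (R + 1 + l) = p * p ^ R * (p * p ^ l) by ring] at htop ⊢
    rw [show a * p * p ^ (R + 1 + l + 1 + R) = a * (p * p ^ R * (p * p ^ R) * (p * p ^ l)) by ring]
      at haptop ⊢
    rw [pow_succ (-1), pow_add p, pow_succ' p R, mul_assoc a p]
    generalize poch p p R = x, poch p p l = y, poch (a * p) p (R + 1 + l + 1 + R) = z,
      poch (a * p) p R = w, p * p ^ R = s, p * p ^ l = t at *
    generalize he : 1 - s * t = e, hd : 1 - a * (s * s * t) = d at *
    field_simp
    rw [← hd, ← he]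
    ring

theorem sum_unitAlpha {a p : K} (ha : 1 - a ≠ 0) {n : ℕ} (hpoch : poch p p n ≠ 0)
    (hap : poch (a * p) p (2 * n) ≠ 0) :
    ∑ r ∈ range (n + 1), unitAlpha a p r / (poch p p (n - r) * poch (a * p) p (n + r))
      = if n = 0 then 1 else 0 := by
  cases n with
  | zero => simp [unitAlpha, div_self ha]
  | succ n =>
    have hn := poch_ne_zero_iff.1 hpoch n n.lt_succ_self
    have happ := poch_ne_zero_iff.1 hap (n + 1 + n) (by omega)
    have hpartial := sum_range_unitAlpha ha n (l := 0) hpoch hap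
    rw [add_zero] at hpartial
    rw [sum_range_succ, hpartial, unitAlpha_succ p ha, if_neg n.succ_ne_zero, Nat.sub_self,
      poch_zero, ← add_assoc (n + 1) n 1, poch_succ (a * p) p (n + 1 + n),
      poch_succ p p n, show a * p ^ (2 * (n + 1)) = a * p * p ^ (n + 1 + n) by ring, pow_succ (-1)]
    field_simp
    ring

theorem isBaileyPair_unit {a p : K} (ha : 1 - a ≠ 0) {N : ℕ} (hpoch : poch p p N ≠ 0)
    (hap : poch (a * p) p (2 * N) ≠ 0) :
    IsBaileyPair a p N (unitAlpha a p) fun n => if n = 0 then 1 else 0 := fun _ hn =>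
  (sum_unitAlpha ha (poch_ne_zero_of_le hpoch hn) (poch_ne_zero_of_le hap (by omega))).symm

/-- One application of Bailey's lemma to the unit Bailey pair. -/
theorem isBaileyPair_of_mul_eq {a p b c X : K} (hX : b * c * X = a * p) (hp : p ≠ 0)
    (ha : 1 - a ≠ 0) {N : ℕ} (hpoch : poch p p N ≠ 0) (hap : poch (a * p) p (2 * N) ≠ 0)
    (hb : poch (b * X) p N ≠ 0) (hc : poch (c * X) p N ≠ 0) :
    IsBaileyPair a p N
      (fun r => poch b p r * poch c p r * X ^ r * unitAlpha a p r /
        (poch (b * X) p r * poch (c * X) p r))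
      fun n => poch X p n / (poch p p n * poch (b * X) p n * poch (c * X) p n) := by
  intro n hn
  have hpoch := poch_ne_zero_of_le hpoch hn
  have hap := poch_ne_zero_of_le hap (Nat.mul_le_mul_left 2 hn)
  have hb := poch_ne_zero_of_le hb hn
  have hc := poch_ne_zero_of_le hc hn
  apply mul_left_cancel₀ (mul_ne_zero hb hc)
  rw [← (isBaileyPair_unit ha hpoch hap).sum_eq hX hp hpoch hap hb hc,
    sum_eq_single 0 (fun m _ hm => by rw [if_neg hm, mul_zero]) (by simp)]
  simp only [poch_zero, pow_zero, if_true, Nat.sub_zero, one_mul, mul_one]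
  generalize poch (b * X) p n = x, poch (c * X) p n = y at *
  field_simp

theorem watson {a p b c d e X Y : K} (hX : b * c * X = a * p) (hY : d * e * Y = a * p)
    (hp : p ≠ 0) (ha : 1 - a ≠ 0) {N : ℕ} (hpoch : poch p p N ≠ 0)
    (hap : poch (a * p) p (2 * N) ≠ 0) (hb : poch (b * X) p N ≠ 0) (hc : poch (c * X) p N ≠ 0)
    (hd : poch (d * Y) p N ≠ 0) (he : poch (e * Y) p N ≠ 0) :
    ∑ n ∈ range (N + 1), poch d p n * poch e p n * Y ^ n * poch Y p (N - n) / poch p p (N - n) *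
        (poch X p n / (poch p p n * poch (b * X) p n * poch (c * X) p n))
      = poch (d * Y) p N * poch (e * Y) p N *
        ∑ r ∈ range (N + 1), poch b p r * poch c p r * poch d p r * poch e p r *
          (X * Y) ^ r * unitAlpha a p r /
          (poch (b * X) p r * poch (c * X) p r * poch (d * Y) p r * poch (e * Y) p r) /
          (poch p p (N - r) * poch (a * p) p (N + r)) := by
  rw [(isBaileyPair_of_mul_eq hX hp ha hpoch hap hb hc).sum_eq hY hp hpoch hap hd he]
  congr 1
  refine sum_congr rfl fun r _ => ?_
  simp only [div_eq_mul_inv, mul_inv, mul_pow]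
  ring

end Watson

/-! ### Antisymmetry of the very-well-poised series around its middle -/

section Antisymmetry

variable {K : Type*} [Field K]

theorem poch_reverse {p : K} (hp : p ≠ 0) {x y : K} {k : ℕ} (hxy : x * y * p ^ k = p) :
    poch x p k = (-x) ^ k * p ^ k.choose 2 * poch y p k := by
  have hmonomial : (-x) ^ k * p ^ k.choose 2 = ∏ i ∈ range k, (-x * p ^ i) := by
    rw [prod_mul_distrib, prod_const, card_range, prod_pow_eq_pow_sum, sum_range_id,
      Nat.choose_two_right]
  rw [poch, poch, ← prod_range_reflect (fun i => 1 - y * p ^ i), hmonomial, ← prod_mul_distrib]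
  refine prod_congr rfl fun i hi => ?_
  obtain ⟨l, rfl⟩ := Nat.exists_eq_add_of_lt (mem_range.1 hi)
  have hfactor : x * p ^ i * (y * p ^ l) = 1 := by
    apply mul_right_cancel₀ hp
    rw [one_mul]
    convert hxy using 1
    ring
  rw [show i + l + 1 - 1 - i = l by omega]
  linear_combination -hfactor

theorem two_mul_choose_two_add (k : ℕ) : 2 * k.choose 2 + k = k * k := by
  induction k with
  | zero => rfl
  | succ k ih =>
    rw [Nat.choose_succ_succ' k 1, Nat.choose_one_right]
    linarith

theorem poch_self_mul_eq {p b : K} {k l : ℕ} (hp : p ≠ 0) (hb : b * p ^ (k + l) = 1) :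
    poch p p (k + l) * ((-1) ^ k * p ^ k.choose 2) =
      poch p p l * poch b p k * (p ^ (k + l)) ^ k := by
  have hsign : ((-1 : K) ^ k) * (-1) ^ k = 1 := by rw [← mul_pow, neg_one_mul, neg_neg, one_pow]
  have hpow : (p ^ (k + l)) ^ k = p ^ k.choose 2 * p ^ k.choose 2 * p ^ k * p ^ (l * k) := by
    rw [← pow_mul, ← pow_add, ← pow_add, ← pow_add, ← two_mul, two_mul_choose_two_add, add_mul]
  have hreverse : p * p ^ l * b * p ^ k = p := by rw [pow_add] at hb; linear_combination p * hb
  rw [hpow, add_comm k l, poch_add, poch_reverse hp hreverse, neg_pow, mul_pow, ← pow_mul]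
  linear_combination (poch p p l * p ^ k * p ^ (l * k) * p ^ k.choose 2 * p ^ k.choose 2 *
    poch b p k) * hsign

/-- The terms of the very-well-poised series in base `p` all of whose parameters equal `a`. -/
def vwpTerm (a p : K) (k : ℕ) : K :=
  (1 - a * p ^ (2 * k)) * (poch a p k / poch p p k) ^ 6 * (p ^ 2 / a ^ 3) ^ k

/-- When `a = p^(-k-l)`, the term `k` is antisymmetric under the exchange of `k` and `l`. -/
theorem vwpTerm_of_mul_pow_eq_one {p b : K} {k l : ℕ} (hp : p ≠ 0) (hb : b * p ^ (k + l) = 1)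
    (hk : poch p p k ≠ 0) (hl : poch p p l ≠ 0) :
    vwpTerm b p k = (poch p p (k + l) / (poch p p k * poch p p l)) ^ 6 *
      (1 / p ^ k - 1 / p ^ l) / p ^ (3 * (k * l)) := by
  have hpoch : poch b p k = poch p p (k + l) * ((-1) ^ k * p ^ k.choose 2) /
      (poch p p l * (p ^ (k + l)) ^ k) := by
    rw [poch_self_mul_eq hp hb]; field_simp
  have hsign : ((-1 : K) ^ k) ^ 6 = 1 := by rw [pow_right_comm]; norm_num
  have hchoose : (p ^ k.choose 2) ^ 6 * (p ^ k) ^ 3 = p ^ (3 * (k * k)) := by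
    rw [← two_mul_choose_two_add k]; ring
  have harg : (p ^ 2 / (1 / p ^ (k + l)) ^ 3) ^ k =
      (p ^ k) ^ 2 * p ^ (3 * (k * k)) * p ^ (3 * (k * l)) := by
    rw [one_div, inv_pow, div_inv_eq_mul]; ring
  have hden : ((p ^ (k + l)) ^ k) ^ 6 =
      p ^ (3 * (k * k)) * p ^ (3 * (k * k)) * p ^ (3 * (k * l)) * p ^ (3 * (k * l)) := by ring
  rw [vwpTerm, hpoch, eq_one_div_of_mul_eq_one_left hb, harg, div_div, div_pow, mul_pow, mul_pow,
    hsign, mul_pow, mul_pow, hden, ← hchoose, div_pow, mul_pow, pow_mul p 2 k, pow_right_comm,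
    pow_add]
  have hs : p ^ k ≠ 0 := pow_ne_zero _ hp
  have ht : p ^ l ≠ 0 := pow_ne_zero _ hp
  have hkl : p ^ (3 * (k * l)) ≠ 0 := pow_ne_zero _ hp
  have hc : p ^ k.choose 2 ≠ 0 := pow_ne_zero _ hp
  generalize p ^ k = s, p ^ l = t, p ^ (3 * (k * l)) = z, p ^ k.choose 2 = y at *
  field_simp

theorem sum_vwpTerm_mul_eq_zero [CharZero K] {p b : K} {N : ℕ} (hp : p ≠ 0)
    (hb : b * p ^ N = 1) (hpoch : poch p p N ≠ 0) {φ : ℕ → K}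
    (hφ : ∀ k ≤ N, φ (N - k) = φ k) : ∑ k ∈ range (N + 1), vwpTerm b p k * φ k = 0 := by
  suffices ∑ k ∈ range (N + 1), vwpTerm b p k * φ k =
      - ∑ k ∈ range (N + 1), vwpTerm b p k * φ k from self_eq_neg.1 this
  conv_lhs => rw [← sum_range_reflect]
  rw [← sum_neg_distrib]
  refine sum_congr rfl fun k hk => ?_
  have hk : k ≤ N := mem_range_succ_iff.1 hk
  rw [Nat.add_sub_cancel, hφ k hk]
  obtain ⟨l, rfl⟩ := Nat.exists_eq_add_of_le hk
  have hpk : poch p p k ≠ 0 := poch_ne_zero_of_le hpoch hk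
  have hpl : poch p p l ≠ 0 := poch_ne_zero_of_le hpoch (Nat.le_add_left l k)
  rw [Nat.add_sub_cancel_left, vwpTerm_of_mul_pow_eq_one hp hb hpk hpl,
    vwpTerm_of_mul_pow_eq_one hp (add_comm k l ▸ hb) hpl hpk, add_comm l k, mul_comm l k,
    mul_comm (poch p p l)]
  ring

theorem sum_range_sub_reflect (f : ℕ → K) {N k : ℕ} (hk : k ≤ N) :
    ∑ j ∈ range (N - k), (f (j + 1) - f (N - j)) = ∑ j ∈ range k, (f (j + 1) - f (N - j)) := by
  have reflect : ∀ k ≤ N, ∑ j ∈ range k, f (N - j) =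
      ∑ j ∈ range N, f (j + 1) - ∑ j ∈ range (N - k), f (j + 1) := by
    intro k hk
    obtain ⟨l, rfl⟩ := Nat.exists_eq_add_of_le' hk
    rw [sum_range_add, Nat.add_sub_cancel, add_sub_cancel_left, ← sum_range_reflect]
    refine sum_congr rfl fun j hj => congrArg f ?_
    have := mem_range.1 hj
    omega
  rw [sum_sub_distrib, sum_sub_distrib, reflect k hk, reflect (N - k) (N.sub_le k),
    Nat.sub_sub_self hk]
  ring

/-- The sum `∑ x / (1 - x)²` over the factors `1 - x` of `(a; p)_k`; up to a power of `1 - q` it is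
one of the two halves of the harmonic sum `innerSum`. -/
def sqHarmonic (a p : K) (k : ℕ) : K := ∑ i ∈ range k, a * p ^ i / (1 - a * p ^ i) ^ 2

/-- The logarithmic derivative at `u = 1`, in the variable `(1 - u)² / u`, of
`(a u; p)_k (a / u; p)_k / ((p u; p)_k (p / u; p)_k)`. -/
def pairCoeff (a p : K) (k : ℕ) : K := sqHarmonic p p k - sqHarmonic a p k

/-- The logarithmic derivative at `u = 1`, in the variable `1 - u⁻¹`, of
`u^k (a / u; p)_k / (p u; p)_k`. -/
def endCoeff (a p : K) (k : ℕ) : K :=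
  ∑ i ∈ range k, (a * p ^ i / (1 - a * p ^ i) + 1 / (1 - p * p ^ i))

section Reflection

variable {p b : K} {N k : ℕ}

theorem mul_pow_eq_inv_of_mul_pow_eq_one (hb : b * p ^ N = 1) {i : ℕ} (hi : i ≤ N) :
    b * p ^ i = (p ^ (N - i))⁻¹ :=
  eq_inv_of_mul_eq_one_left (by rw [mul_assoc, ← pow_add, Nat.add_sub_cancel' hi, hb])

theorem inv_div_one_sub_inv_sq (x : K) : x⁻¹ / (1 - x⁻¹) ^ 2 = x / (1 - x) ^ 2 := by
  rcases eq_or_ne x 0 with rfl | hx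
  · simp
  · rw [show 1 - x⁻¹ = -(1 - x) / x by field_simp; ring, div_pow, neg_sq]
    field_simp

theorem inv_div_one_sub_inv {x : K} (hx : x ≠ 0) : x⁻¹ / (1 - x⁻¹) = -(1 / (1 - x)) := by
  rw [show 1 - x⁻¹ = -(1 - x) / x by field_simp; ring]
  field_simp

theorem pairCoeff_reflect (hb : b * p ^ N = 1) (hk : k ≤ N) :
    pairCoeff b p (N - k) = pairCoeff b p k := by
  have expand : ∀ k ≤ N, pairCoeff b p k =
      ∑ i ∈ range k,
        (p ^ (i + 1) / (1 - p ^ (i + 1)) ^ 2 - p ^ (N - i) / (1 - p ^ (N - i)) ^ 2) := by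
    intro k hk
    rw [pairCoeff, sqHarmonic, sqHarmonic, ← sum_sub_distrib]
    refine sum_congr rfl fun i hi => ?_
    rw [mul_pow_eq_inv_of_mul_pow_eq_one hb ((mem_range.1 hi).le.trans hk), ← pow_succ',
      inv_div_one_sub_inv_sq]
  rw [expand k hk, expand (N - k) (N.sub_le k),
    sum_range_sub_reflect (fun j => p ^ j / (1 - p ^ j) ^ 2) hk]

theorem endCoeff_reflect (hp : p ≠ 0) (hb : b * p ^ N = 1) (hk : k ≤ N) :
    endCoeff b p (N - k) = endCoeff b p k := by
  have expand : ∀ k ≤ N, endCoeff b p k =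
      ∑ i ∈ range k, (1 / (1 - p ^ (i + 1)) - 1 / (1 - p ^ (N - i))) := by
    intro k hk
    refine sum_congr rfl fun i hi => ?_
    rw [mul_pow_eq_inv_of_mul_pow_eq_one hb ((mem_range.1 hi).le.trans hk), ← pow_succ',
      inv_div_one_sub_inv (pow_ne_zero _ hp)]
    ring
  rw [expand k hk, expand (N - k) (N.sub_le k),
    sum_range_sub_reflect (fun j => 1 / (1 - p ^ j)) hk]

theorem sum_vwpTerm_mul_coeff_eq_zero [CharZero K] (hp : p ≠ 0) (hb : b * p ^ N = 1)
    (hpoch : poch p p N ≠ 0) :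
    ∑ k ∈ range (N + 1), vwpTerm b p k * (pairCoeff b p k ^ 2 * endCoeff b p k) = 0 :=
  sum_vwpTerm_mul_eq_zero hp hb hpoch fun _ hk => by
    rw [pairCoeff_reflect hb hk, endCoeff_reflect hp hb hk]

end Reflection

end Antisymmetry

/-! ### Two specialisations of Watson's transformation -/

section SpecialWatson

variable {K : Type*} [Field K]

theorem unitAlpha_div {a p u : K} {N r : ℕ} (hr : r ≤ N) (hu : a * p ^ N = u) (hu₀ : u ≠ 0)
    (hp : p ≠ 0) (ha : 1 - a ≠ 0) (hpoch : poch p p N ≠ 0) (hap : poch (a * p) p (2 * N) ≠ 0) :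
    poch p p N * poch a p N * (1 - u) *
        (unitAlpha a p r / (poch p p (N - r) * poch (a * p) p (N + r))) =
      (1 - a * p ^ (2 * r)) * (poch a p r / poch p p r) *
        (poch (a / u) p r / poch (p * u) p r) * (p ^ N) ^ r := by
  have hshift : a * p * p ^ N = p * u := by rw [← hu]; ring
  have hau : a / u * p ^ N = 1 := by rw [div_mul_eq_mul_div, hu, div_self hu₀]
  have hapN : poch (a * p) p N ≠ 0 := poch_ne_zero_of_le hap (by omega)
  have hwrap : poch a p N * (1 - u) = (1 - a) * poch (a * p) p N := by
    rw [← poch_succ', poch_succ, hu]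
  obtain ⟨l, rfl⟩ := Nat.exists_eq_add_of_le hr
  have hreflect := poch_self_mul_eq hp hau
  have hpr : poch p p r ≠ 0 := poch_ne_zero_of_le hpoch hr
  have hpl : poch p p l ≠ 0 := poch_ne_zero_of_le hpoch (Nat.le_add_left l r)
  rw [Nat.add_sub_cancel_left, poch_add (a * p) p (r + l) r, hshift, unitAlpha]
  calc
    _ = poch a p (r + l) * (1 - u) * (poch p p (r + l) * ((-1) ^ r * p ^ r.choose 2)) *
        ((1 - a * p ^ (2 * r)) / (1 - a) * poch a p r / poch p p r /
          (poch p p l * (poch (a * p) p (r + l) * poch (p * u) p r))) := by ring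
    _ = _ := by
      rw [hwrap, hreflect]
      generalize poch p p l = x, poch (a * p) p (r + l) = y at *
      field_simp

theorem watson_of_mul_pow {a p u b c d e X Y B C D E : K} {N : ℕ} (hX : b * c * X = a * p)
    (hY : d * e * Y = a * p) (hB : b * X = B) (hC : c * X = C) (hD : d * Y = D) (hE : e * Y = E)
    (hu : a * p ^ N = u) (hu₀ : u ≠ 0) (hp : p ≠ 0) (ha : 1 - a ≠ 0)
    (hpoch : poch p p N ≠ 0) (hap : poch (a * p) p (2 * N) ≠ 0)
    (hb : poch B p N ≠ 0) (hc : poch C p N ≠ 0) (hd : poch D p N ≠ 0) (he : poch E p N ≠ 0) :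
    ∑ r ∈ range (N + 1), (1 - a * p ^ (2 * r)) * (poch a p r / poch p p r) *
          (poch (a / u) p r / poch (p * u) p r) *
          (poch b p r * poch c p r / (poch B p r * poch C p r)) *
          (poch d p r * poch e p r / (poch D p r * poch E p r)) * (X * Y * p ^ N) ^ r
      = poch p p N * poch a p N * (1 - u) / (poch D p N * poch E p N) *
        ∑ n ∈ range (N + 1),
          poch d p n * poch e p n * Y ^ n * poch Y p (N - n) / poch p p (N - n) *
          (poch X p n / (poch p p n * poch B p n * poch C p n)) := by
  subst hB hC hD hE
  rw [watson hX hY hp ha hpoch hap hb hc hd he, div_mul_eq_mul_div, mul_left_comm,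
    mul_div_cancel_left₀ _ (mul_ne_zero hd he), mul_sum]
  refine sum_congr rfl fun r hr => ?_
  have hα := unitAlpha_div (mem_range_succ_iff.1 hr) hu hu₀ hp ha hpoch hap
  rw [mul_pow]
  calc
    _ = (poch b p r * poch c p r / (poch (b * X) p r * poch (c * X) p r)) *
          (poch d p r * poch e p r / (poch (d * Y) p r * poch (e * Y) p r)) * (X * Y) ^ r *
          ((1 - a * p ^ (2 * r)) * (poch a p r / poch p p r) *
            (poch (a / u) p r / poch (p * u) p r) * (p ^ N) ^ r) := by ring
    _ = _ := by
      rw [← hα]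
      simp only [div_eq_mul_inv, mul_inv]
      ring

theorem reverse_monomial {a p Y : K} {n l : ℕ} (hp : p ≠ 0) (hY : a ^ 2 * Y * p ^ (n + l) = p) :
    a ^ (n + l) * ((-a) ^ (n + l) * p ^ (n + l).choose 2) * ((-Y) ^ l * p ^ l.choose 2 * Y ^ n) *
      (p ^ (n + l)) ^ n = (-1) ^ n * p ^ n.choose 2 * p ^ n := by
  have hsign : ((-1 : K) ^ l) * (-1) ^ l = 1 := by rw [← mul_pow, neg_one_mul, neg_neg, one_pow]
  have hbalance : a ^ (n + l) * a ^ (n + l) * (Y ^ n * Y ^ l) * p ^ ((n + l) * (n + l)) =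
      p ^ (n + l) := by
    rw [pow_mul, ← pow_add Y, ← mul_pow, ← mul_pow, ← mul_pow, ← sq, hY]
  have hexponent : p ^ (n + l) * p ^ (n + l).choose 2 * p ^ l.choose 2 * (p ^ (n + l)) ^ n =
      p ^ n * p ^ n.choose 2 * p ^ ((n + l) * (n + l)) := by
    rw [← pow_mul, ← pow_add, ← pow_add, ← pow_add, ← pow_add, ← pow_add]
    congr 1
    linarith [two_mul_choose_two_add (n + l), two_mul_choose_two_add n, two_mul_choose_two_add l]
  apply mul_right_cancel₀ (pow_ne_zero ((n + l) * (n + l)) hp)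
  rw [neg_pow a, neg_pow Y, pow_add (-1 : K)]
  calc
    _ = (a ^ (n + l) * a ^ (n + l) * (Y ^ n * Y ^ l) * p ^ ((n + l) * (n + l))) *
          ((-1) ^ l * (-1) ^ l) * (-1) ^ n *
          (p ^ (n + l).choose 2 * p ^ l.choose 2 * (p ^ (n + l)) ^ n) := by ring
    _ = _ := by rw [hbalance, hsign]; linear_combination (-1) ^ n * hexponent

/-- The reversals that bring the balanced series with top parameter `p / (a u)` into the shape
common to all specialisations. -/
theorem poch_reverse_prefactor {a p u : K} {N n : ℕ} (hn : n ≤ N) (hu : a * p ^ N = u)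
    (hu₀ : u ≠ 0) (ha : a ≠ 0) (hp : p ≠ 0) :
    poch a p N * (poch (p / (a * u)) p (N - n) * (p / (a * u)) ^ n) * poch p p N =
      (a ^ N)⁻¹ * poch (p / u) p N * poch p p (N - n) * poch (a ^ 2 * p ^ n) p (N - n) *
        poch (a / u) p n * p ^ n := by
  obtain ⟨l, rfl⟩ := Nat.exists_eq_add_of_le hn
  have hY : a ^ 2 * (p / (a * u)) * p ^ (n + l) = p := by field_simp; exact hu
  have hself := poch_self_mul_eq (k := n) (l := l) hp
    (show a / u * p ^ (n + l) = 1 by rw [div_mul_eq_mul_div, hu, div_self hu₀])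
  rw [Nat.add_sub_cancel_left,
    poch_reverse hp (show a * (p / u) * p ^ (n + l) = p by rw [mul_right_comm, hu]; field_simp),
    poch_reverse hp (show p / (a * u) * (a ^ 2 * p ^ n) * p ^ l = p by
      rw [pow_add] at hY; linear_combination hY)]
  have hmonomial := reverse_monomial hp hY
  apply mul_left_cancel₀ (pow_ne_zero n (pow_ne_zero (n + l) hp))
  apply mul_left_cancel₀ (pow_ne_zero (n + l) ha)
  calc
    _ = (a ^ (n + l) * ((-a) ^ (n + l) * p ^ (n + l).choose 2) *
          ((-(p / (a * u))) ^ l * p ^ l.choose 2 * (p / (a * u)) ^ n) * (p ^ (n + l)) ^ n) *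
          poch (p / u) p (n + l) * poch (a ^ 2 * p ^ n) p l * poch p p (n + l) := by ring
    _ = poch (p / u) p (n + l) * poch (a ^ 2 * p ^ n) p l * p ^ n *
          (poch p p (n + l) * ((-1) ^ n * p ^ n.choose 2)) := by rw [hmonomial]; ring
    _ = _ := by
      rw [hself]
      generalize poch (p / u) p (n + l) = x, poch (a ^ 2 * p ^ n) p l = y at *
      field_simp

end SpecialWatson

/-! ### Well-poised sums with two symmetric pairs of parameters -/

section WellPoised

variable {K : Type*} [Field K]

/-- The symmetric pair `(c x; p)_k (c / x; p)_k` of shifted factorials. -/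
def pairPoch (c p x : K) (k : ℕ) : K := poch (c * x) p k * poch (c / x) p k

theorem pairPoch_one (c p : K) (k : ℕ) : pairPoch c p 1 k = poch c p k ^ 2 := by
  rw [pairPoch, mul_one, div_one, sq]

/-- The part of a very-well-poised term that does not involve the free parameters. -/
def baseTerm (a p : K) (k : ℕ) : K :=
  (1 - a * p ^ (2 * k)) * (poch a p k / poch p p k) * (p ^ 2 / a ^ 3) ^ k

/-- The contribution `(a x; p)_k (a / x; p)_k / ((p x; p)_k (p / x; p)_k)` of a symmetric pair of
parameters to a very-well-poised term. -/
def pairRatio (a p x : K) (k : ℕ) : K := pairPoch a p x k / pairPoch p p x k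

/-- The contribution of a single parameter `a / z`, with its share `z ^ k` of the argument, to a
very-well-poised term. -/
def endRatio (a p z : K) (k : ℕ) : K := poch (a / z) p k / poch (p * z) p k * z ^ k

theorem pairRatio_one (a p : K) (k : ℕ) : pairRatio a p 1 k = (poch a p k / poch p p k) ^ 2 := by
  rw [pairRatio, pairPoch_one, pairPoch_one, div_pow]

theorem endRatio_one (a p : K) (k : ℕ) : endRatio a p 1 k = poch a p k / poch p p k := by
  rw [endRatio, div_one, mul_one, one_pow, mul_one]

theorem vwpTerm_eq (a p : K) (k : ℕ) :
    vwpTerm a p k = baseTerm a p k * pairRatio a p 1 k ^ 2 * endRatio a p 1 k := by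
  rw [pairRatio_one, endRatio_one, vwpTerm, baseTerm]; ring

/-- The very-well-poised sum with the symmetric pairs `a x^{±1}`, `a y^{±1}` and the single
parameter `a / z`; for `x = y = z = 1` it is the sum of `vwpTerm`. -/
def wellPoisedSum (a p : K) (N : ℕ) (x y z : K) : K :=
  ∑ k ∈ range (N + 1), baseTerm a p k * pairRatio a p x k * pairRatio a p y k * endRatio a p z k

/-- The second mixed difference of `wellPoisedSum` between `1` and `u` in the two pairs. -/
def mixedDifference (a p : K) (N : ℕ) (u : K) (e : ℕ → K) : K :=
  ∑ k ∈ range (N + 1), baseTerm a p k * (pairRatio a p 1 k - pairRatio a p u k) ^ 2 * e k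

theorem mixedDifference_eq (a p : K) (N : ℕ) (u z : K) :
    mixedDifference a p N u (endRatio a p z) =
      wellPoisedSum a p N 1 1 z - wellPoisedSum a p N 1 u z - wellPoisedSum a p N u 1 z +
        wellPoisedSum a p N u u z := by
  simp only [mixedDifference, wellPoisedSum, ← sum_sub_distrib, ← sum_add_distrib]
  exact sum_congr rfl fun k _ => by ring

/-- Watson's transformation applies to all sums on the right but the last one, which is small. -/
theorem sum_vwpTerm_eq_wellPoisedSum (a p : K) (N : ℕ) (u : K) :
    ∑ k ∈ range (N + 1), vwpTerm a p k =
      2 * wellPoisedSum a p N u 1 1 - wellPoisedSum a p N u u 1 +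
        (mixedDifference a p N u (endRatio a p u) +
          mixedDifference a p N u fun k => endRatio a p 1 k - endRatio a p u k) := by
  simp only [mixedDifference, wellPoisedSum, mul_sum, ← sum_sub_distrib, ← sum_add_distrib,
    vwpTerm_eq]
  exact sum_congr rfl fun k _ => by ring

/-- The coefficients of the balanced series for `wellPoisedSum a p N u y 1`, `u = a p^N`. -/
def balancedCoeff (a p u : K) (N n : ℕ) : K :=
  (1 - u) * (a ^ N)⁻¹ / poch p p N * poch (a ^ 2 * p ^ n) p (N - n) * poch a p n *
    poch (p / a) p n * p ^ n / poch p p n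

/-- The coefficients of the balanced series for `wellPoisedSum a p N x y u`, `u = a p^N`. -/
def balancedCoeff' (a p u : K) (N n : ℕ) : K :=
  poch p p N * poch a p N * (1 - u) * (p / a) ^ n * poch (p / a) p (N - n) * poch (p / a) p n /
    (poch p p (N - n) * poch p p n)

/-- The nonvanishing conditions under which Watson's transformation applies to a series in base
`p` that terminates through its parameter `a / u = p^(-N)`. -/
structure IsGeneric (a p u : K) (N : ℕ) : Prop where
  mul_pow : a * p ^ N = u
  u_ne_zero : u ≠ 0
  p_ne_zero : p ≠ 0
  one_sub_ne_zero : 1 - a ≠ 0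
  poch_self_ne_zero : poch p p N ≠ 0
  poch_mul_ne_zero : poch (a * p) p (2 * N) ≠ 0

namespace IsGeneric

variable {a p u x y : K} {N : ℕ} (h : IsGeneric a p u N)
include h

theorem a_ne_zero : a ≠ 0 := by
  rintro rfl
  exact h.u_ne_zero (by rw [← h.mul_pow, zero_mul])

theorem watson_term_eq (y : K) {n : ℕ} (hn : n ≤ N) (hu : poch (p / u) p N ≠ 0) :
    poch p p N * poch a p N * (1 - u) / (poch p p N * poch (p / u) p N) *
      (poch (a * u) p n * poch a p n * (p / (a * u)) ^ n * poch (p / (a * u)) p (N - n) /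
        poch p p (N - n) *
          (poch (p / a) p n / (poch p p n * poch (p * y) p n * poch (p / y) p n))) =
      balancedCoeff a p u N n * (pairPoch a p u n / pairPoch p p y n) := by
  have hreverse := poch_reverse_prefactor hn h.mul_pow h.u_ne_zero h.a_ne_zero h.p_ne_zero
  have hpN := h.poch_self_ne_zero
  have hpn : poch p p n ≠ 0 := poch_ne_zero_of_le hpN hn
  have hpl : poch p p (N - n) ≠ 0 := poch_ne_zero_of_le hpN (N.sub_le n)
  rw [balancedCoeff, pairPoch, pairPoch]
  calc
    _ = (poch a p N * (poch (p / (a * u)) p (N - n) * (p / (a * u)) ^ n) * poch p p N) *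
        ((1 - u) * poch (a * u) p n * poch a p n / poch p p (N - n) / (poch p p N *
          poch (p / u) p N) * poch (p / a) p n /
          (poch p p n * (poch (p * y) p n * poch (p / y) p n))) := by ring
    _ = _ := by
      rw [hreverse]
      generalize poch (p * y) p n * poch (p / y) p n = z, poch p p (N - n) = x₁,
        poch p p n = x₂, poch p p N = x₃, (a ^ N)⁻¹ = x₄, poch (p / u) p N = x₅,
        poch (p / a) p n = x₆, poch (a / u) p n = x₇ at *
      field_simp

theorem wellPoisedSum_one (hy₀ : y ≠ 0) (hy : pairPoch p p y N ≠ 0) (hu : poch (p / u) p N ≠ 0) :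
    wellPoisedSum a p N u y 1 =
      ∑ n ∈ range (N + 1), balancedCoeff a p u N n *
        (pairPoch a p u n / pairPoch p p y n) := by
  have ha := h.a_ne_zero
  have hu₀ := h.u_ne_zero
  have hp := h.p_ne_zero
  have hpN := h.poch_self_ne_zero
  have hwatson := watson_of_mul_pow (b := a * y) (c := a / y) (d := a * u) (e := a) (X := p / a)
    (Y := p / (a * u)) (B := p * y) (C := p / y) (D := p) (E := p / u) (by field_simp)
    (by field_simp) (by field_simp) (by field_simp) (by field_simp) (by field_simp) h.mul_pow hu₀
    hp h.one_sub_ne_zero hpN h.poch_mul_ne_zero (left_ne_zero_of_mul hy)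
    (right_ne_zero_of_mul hy) hpN hu
  have hargument : p / a * (p / (a * u)) * p ^ N = p ^ 2 / a ^ 3 := by
    field_simp; exact h.mul_pow
  rw [hargument] at hwatson
  calc
    _ = _ := sum_congr rfl fun k _ => by
      rw [baseTerm, pairRatio, pairRatio, endRatio_one, pairPoch, pairPoch, pairPoch, pairPoch]
      simp only [div_eq_mul_inv, mul_inv]
      ring
    _ = _ := hwatson
    _ = _ := by
      rw [mul_sum]
      exact sum_congr rfl fun n hn => h.watson_term_eq y (mem_range_succ_iff.1 hn) hu

theorem wellPoisedSum_self (hx₀ : x ≠ 0) (hy₀ : y ≠ 0) (hx : pairPoch p p x N ≠ 0)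
    (hy : pairPoch p p y N ≠ 0) :
    wellPoisedSum a p N x y u =
      ∑ n ∈ range (N + 1), balancedCoeff' a p u N n *
        (pairPoch a p y n / pairPoch p p y N) * (pairPoch p p x n)⁻¹ := by
  have ha := h.a_ne_zero
  have hwatson := watson_of_mul_pow (b := a * x) (c := a / x) (d := a * y) (e := a / y)
    (X := p / a) (Y := p / a) (B := p * x) (C := p / x) (D := p * y) (E := p / y) (by field_simp)
    (by field_simp) (by field_simp) (by field_simp) (by field_simp) (by field_simp) h.mul_pow
    h.u_ne_zero h.p_ne_zero h.one_sub_ne_zero h.poch_self_ne_zero h.poch_mul_ne_zero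
    (left_ne_zero_of_mul hx) (right_ne_zero_of_mul hx) (left_ne_zero_of_mul hy)
    (right_ne_zero_of_mul hy)
  have hargument : p / a * (p / a) * p ^ N = p ^ 2 / a ^ 3 * u := by
    rw [← h.mul_pow]; field_simp
  rw [hargument] at hwatson
  calc
    _ = _ := sum_congr rfl fun k _ => by
      rw [baseTerm, pairRatio, pairRatio, endRatio, pairPoch, pairPoch, pairPoch, pairPoch,
        _root_.mul_pow]
      ring
    _ = _ := hwatson
    _ = _ := by
      rw [mul_sum]
      refine sum_congr rfl fun n _ => ?_
      rw [balancedCoeff', pairPoch, pairPoch, pairPoch]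
      simp only [div_eq_mul_inv, mul_inv]
      ring

end IsGeneric

/-- The right-hand side of the congruence up to a factor `1 - q`, with `p = q^d`, `a = q^r` and
`u = q^(dn-n)`. -/
def balancedSide (a p u : K) (N : ℕ) : K :=
  (1 - u) * (a ^ N)⁻¹ * (poch (a ^ 2) p N / poch p p N) * ∑ n ∈ range (N + 1),
    poch a p n ^ 3 * poch (p / a) p n * p ^ n / (poch p p n ^ 3 * poch (a ^ 2) p n) *
    (1 - (1 - u) ^ 2 * (2 - u) * (sqHarmonic p p n + sqHarmonic a p n))

theorem balancedSide_eq {a p : K} (u : K) {N : ℕ} (ha : poch (a ^ 2) p N ≠ 0) :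
    balancedSide a p u N = ∑ n ∈ range (N + 1), balancedCoeff a p u N n *
      (poch a p n ^ 2 / poch p p n ^ 2 *
        (1 - (1 - u) ^ 2 * (2 - u) * (sqHarmonic p p n + sqHarmonic a p n))) := by
  rw [balancedSide, mul_sum]
  refine sum_congr rfl fun n hn => ?_
  obtain ⟨l, rfl⟩ := Nat.exists_eq_add_of_le (mem_range_succ_iff.1 hn)
  rw [balancedCoeff, Nat.add_sub_cancel_left, poch_add]
  have han : poch (a ^ 2) p n ≠ 0 := poch_ne_zero_of_le ha (Nat.le_add_right n l)
  generalize 1 - (1 - u) ^ 2 * (2 - u) * (sqHarmonic p p n + sqHarmonic a p n) = z,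
    poch (a ^ 2) p n = w₁, poch (p / a) p n = w₂, (a ^ (n + l))⁻¹ = w₃ at *
  field_simp

end WellPoised

/-! ### Congruences and first-order expansions with respect to a valuation -/

section Valuation

variable {K : Type*} [Field K] {Γ : Type*} [LinearOrderedCommGroupWithZero Γ]

/-- Congruence of integral elements modulo the elements of valuation at most `γ`. -/
structure ValModEq (v : Valuation K Γ) (γ : Γ) (x y : K) : Prop where
  left : v x ≤ 1
  right : v y ≤ 1
  sub : v (x - y) ≤ γ

/-- The expansion `x = 1 + ε α + O(ε²)` with integral coefficient `α`. -/
structure FirstOrder (v : Valuation K Γ) (ε x α : K) : Prop where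
  coeff : v α ≤ 1
  sub : v (x - 1 - ε * α) ≤ v ε ^ 2

variable {v : Valuation K Γ} {γ : Γ} {x y z w : K}

theorem ne_zero_of_valuation_eq_one (hx : v x = 1) : x ≠ 0 :=
  (v.ne_zero_iff).1 (hx ▸ one_ne_zero)

namespace ValModEq

theorem refl (hx : v x ≤ 1) : ValModEq v γ x x := ⟨hx, hx, by simp⟩

theorem symm (h : ValModEq v γ x y) : ValModEq v γ y x :=
  ⟨h.right, h.left, by rw [v.map_sub_swap]; exact h.sub⟩

theorem mul (h : ValModEq v γ x y) (h' : ValModEq v γ z w) : ValModEq v γ (x * z) (y * w) := by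
  refine ⟨?_, ?_, ?_⟩
  · rw [map_mul]; exact mul_le_one' h.left h'.left
  · rw [map_mul]; exact mul_le_one' h.right h'.right
  · rw [show x * z - y * w = (x - y) * z + y * (z - w) by ring]
    refine v.map_add_le ?_ ?_
    · rw [map_mul]; exact mul_le_of_le_of_le_one h.sub h'.left
    · rw [map_mul]; exact mul_le_of_le_one_of_le h.right h'.sub

theorem sub' (h : ValModEq v γ x y) (h' : ValModEq v γ z w) : ValModEq v γ (x - z) (y - w) := by
  refine ⟨v.map_sub_le h.left h'.left, v.map_sub_le h.right h'.right, ?_⟩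
  rw [sub_sub_sub_comm]
  exact v.map_sub_le h.sub h'.sub

theorem sum {ι : Type*} {s : Finset ι} {f g : ι → K} (h : ∀ i ∈ s, ValModEq v γ (f i) (g i)) :
    ValModEq v γ (∑ i ∈ s, f i) (∑ i ∈ s, g i) := by
  refine ⟨v.map_sum_le fun i hi => (h i hi).left, v.map_sum_le fun i hi => (h i hi).right, ?_⟩
  rw [← sum_sub_distrib]
  exact v.map_sum_le fun i hi => (h i hi).sub

theorem prod {ι : Type*} {s : Finset ι} {f g : ι → K} (h : ∀ i ∈ s, ValModEq v γ (f i) (g i)) :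
    ValModEq v γ (∏ i ∈ s, f i) (∏ i ∈ s, g i) := by
  classical
  induction s using Finset.induction_on with
  | empty => simpa using refl (map_one v).le
  | insert a s ha ih =>
    rw [prod_insert ha, prod_insert ha]
    exact (h a (mem_insert_self a s)).mul (ih fun i hi => h i (mem_insert_of_mem hi))

theorem pow (h : ValModEq v γ x y) (n : ℕ) : ValModEq v γ (x ^ n) (y ^ n) := by
  induction n with
  | zero => simpa using refl (map_one v).le
  | succ n ih => simpa only [pow_succ] using ih.mul h

theorem inv (h : ValModEq v γ x y) (hx : v x = 1) (hy : v y = 1) : ValModEq v γ x⁻¹ y⁻¹ := by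
  have hx₀ := ne_zero_of_valuation_eq_one hx
  have hy₀ := ne_zero_of_valuation_eq_one hy
  refine ⟨by simp [hx], by simp [hy], ?_⟩
  rw [show x⁻¹ - y⁻¹ = -(x⁻¹ * y⁻¹ * (x - y)) by field_simp; ring, Valuation.map_neg]
  simpa [hx, hy] using h.sub

theorem div (h : ValModEq v γ x y) (h' : ValModEq v γ z w) (hz : v z = 1) (hw : v w = 1) :
    ValModEq v γ (x / z) (y / w) := by
  simpa only [div_eq_mul_inv] using h.mul (h'.inv hz hw)

theorem one_sub_mul_pow {p : K} (h : ValModEq v γ x y) (hp : v p ≤ 1) (i : ℕ) :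
    ValModEq v γ (1 - x * p ^ i) (1 - y * p ^ i) :=
  (refl (map_one v).le).sub' (h.mul (refl (by rw [map_pow]; exact pow_le_one' hp i)))

theorem poch {p : K} (h : ValModEq v γ x y) (hp : v p ≤ 1) (k : ℕ) :
    ValModEq v γ (poch x p k) (poch y p k) :=
  prod fun i _ => h.one_sub_mul_pow hp i

theorem val_eq_one (h : ValModEq v γ x y) (hγ : γ < 1) (hy : v y = 1) : v x = 1 := by
  rw [← hy] at hγ ⊢
  exact v.map_eq_of_sub_lt (h.sub.trans_lt hγ)

end ValModEq

theorem valuation_poch_le_one {p : K} (hx : v x ≤ 1) (hp : v p ≤ 1) (k : ℕ) :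
    v (poch x p k) ≤ 1 :=
  ((ValModEq.refl (γ := 0) hx).poch hp k).left

theorem valuation_poch_eq_one {p : K} {k : ℕ} (h : ∀ i < k, v (1 - x * p ^ i) = 1) :
    v (poch x p k) = 1 := by
  rw [poch, map_prod]
  exact prod_eq_one fun i hi => h i (mem_range.1 hi)

theorem valuation_poch_le_of_factor {p : K} {k i : ℕ} (hx : v x ≤ 1) (hp : v p ≤ 1) (hi : i < k)
    (h : v (1 - x * p ^ i) ≤ γ) : v (poch x p k) ≤ γ := by
  rw [poch, ← mul_prod_erase _ _ (mem_range.2 hi), map_mul, map_prod]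
  exact mul_le_of_le_of_le_one h
    (prod_le_one' fun j _ => ((ValModEq.refl (γ := 0) hx).one_sub_mul_pow hp j).left)

namespace FirstOrder

variable {ε α β : K}

theorem sub_one (h : FirstOrder v ε x α) (hε : v ε < 1) : v (x - 1) ≤ v ε := by
  rw [show x - 1 = (x - 1 - ε * α) + ε * α by ring]
  refine v.map_add_le (h.sub.trans ?_) ?_
  · rw [sq]; exact mul_le_of_le_one_left' hε.le
  · rw [map_mul]; exact mul_le_of_le_one_right' h.coeff

theorem val_eq_one (h : FirstOrder v ε x α) (hε : v ε < 1) : v x = 1 := by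
  rw [← map_one v] at hε ⊢
  exact v.map_eq_of_sub_lt ((h.sub_one (map_one v ▸ hε)).trans_lt hε)

theorem one_add (h : v α ≤ 1) : FirstOrder v ε (1 + ε * α) α :=
  ⟨h, by simp⟩

theorem mul (h : FirstOrder v ε x α) (h' : FirstOrder v ε y β) (hε : v ε < 1) :
    FirstOrder v ε (x * y) (α + β) := by
  refine ⟨v.map_add_le h.coeff h'.coeff, ?_⟩
  rw [show x * y - 1 - ε * (α + β) =
    (x - 1 - ε * α) * y + ((y - 1 - ε * β) + ε * α * (y - 1)) by ring]
  refine v.map_add_le ?_ (v.map_add_le h'.sub ?_)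
  · rw [map_mul, h'.val_eq_one hε, mul_one]; exact h.sub
  · rw [map_mul, map_mul, sq]
    exact mul_le_mul' (mul_le_of_le_one_right' h.coeff) (h'.sub_one hε)

theorem inv (h : FirstOrder v ε x α) (hε : v ε < 1) : FirstOrder v ε x⁻¹ (-α) := by
  have hx := h.val_eq_one hε
  have hx₀ := ne_zero_of_valuation_eq_one hx
  refine ⟨by simpa using h.coeff, ?_⟩
  rw [show x⁻¹ - 1 - ε * -α = x⁻¹ * (-(x - 1 - ε * α) + ε * α * (x - 1)) by field_simp; ring,
    map_mul, map_inv₀, hx, inv_one, one_mul]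
  refine v.map_add_le (by rw [Valuation.map_neg]; exact h.sub) ?_
  rw [map_mul, map_mul, sq]
  exact mul_le_mul' (mul_le_of_le_one_right' h.coeff) (h.sub_one hε)

theorem prod {ι : Type*} {s : Finset ι} {f g : ι → K} (hε : v ε < 1)
    (h : ∀ i ∈ s, FirstOrder v ε (f i) (g i)) :
    FirstOrder v ε (∏ i ∈ s, f i) (∑ i ∈ s, g i) := by
  classical
  induction s using Finset.induction_on with
  | empty => exact ⟨by simp, by simp⟩
  | insert a s ha ih =>
    rw [prod_insert ha, sum_insert ha]
    exact (h a (mem_insert_self a s)).mul (ih fun i hi => h i (mem_insert_of_mem hi)) hε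

end FirstOrder

/-! ### First-order expansions of the ingredients of the well-poised sums -/

variable {a c p u : K} {k : ℕ}

theorem pairPoch_div_sq (hu : u ≠ 0) (hc : ∀ i < k, 1 - c * p ^ i ≠ 0) :
    pairPoch c p u k / poch c p k ^ 2 =
      ∏ i ∈ range k, (1 + (1 - u) ^ 2 / u * -(c * p ^ i / (1 - c * p ^ i) ^ 2)) := by
  simp only [pairPoch, poch, ← prod_pow, ← prod_mul_distrib, ← prod_div_distrib]
  refine prod_congr rfl fun i hi => ?_
  have hfactor := hc i (mem_range.1 hi)
  rw [div_mul_eq_mul_div c u, mul_right_comm c u]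
  generalize c * p ^ i = X at *
  field_simp
  ring

theorem firstOrder_pairPoch (hu : u ≠ 0) (hε : v ((1 - u) ^ 2 / u) < 1) (hc : v c ≤ 1)
    (hp : v p ≤ 1) (hcp : ∀ i < k, v (1 - c * p ^ i) = 1) :
    FirstOrder v ((1 - u) ^ 2 / u) (pairPoch c p u k / poch c p k ^ 2) (-sqHarmonic c p k) := by
  rw [pairPoch_div_sq hu fun i hi => ne_zero_of_valuation_eq_one (hcp i hi), sqHarmonic,
    ← sum_neg_distrib]
  refine FirstOrder.prod hε fun i hi => FirstOrder.one_add ?_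
  rw [Valuation.map_neg, map_div₀, map_pow, hcp i (mem_range.1 hi), one_pow, div_one, map_mul,
    map_pow]
  exact mul_le_one' hc (pow_le_one' hp i)

theorem firstOrder_pairRatio (hu : u ≠ 0) (hε : v ((1 - u) ^ 2 / u) < 1) (ha : v a ≤ 1)
    (hp : v p ≤ 1) (hap : ∀ i < k, v (1 - a * p ^ i) = 1) (hpp : ∀ i < k, v (1 - p * p ^ i) = 1) :
    FirstOrder v ((1 - u) ^ 2 / u) (pairRatio a p u k / pairRatio a p 1 k) (pairCoeff a p k) := by
  convert (firstOrder_pairPoch hu hε ha hp hap).mul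
    ((firstOrder_pairPoch hu hε hp hp hpp).inv hε) hε using 1
  · rw [pairRatio_one, pairRatio]
    simp only [div_eq_mul_inv, mul_inv, mul_pow, inv_pow, inv_inv]
    ring
  · rw [pairCoeff]; ring

theorem firstOrder_endRatio (hu : u ≠ 0) (hε : v (1 - u⁻¹) < 1) (ha : v a ≤ 1)
    (hp : v p ≤ 1) (hap : ∀ i < k, v (1 - a * p ^ i) = 1) (hpp : ∀ i < k, v (1 - p * p ^ i) = 1) :
    FirstOrder v (1 - u⁻¹) (endRatio a p u k / endRatio a p 1 k) (endCoeff a p k) := by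
  have hproduct : endRatio a p u k / endRatio a p 1 k =
      ∏ i ∈ range k, ((1 + (1 - u⁻¹) * (a * p ^ i / (1 - a * p ^ i))) *
        (1 + (1 - u⁻¹) * -(1 / (1 - p * p ^ i)))⁻¹) := by
    rw [endRatio_one, endRatio, ← card_range k, ← prod_const, card_range]
    simp only [poch, ← prod_div_distrib, ← prod_mul_distrib]
    refine prod_congr rfl fun i hi => ?_
    have hQ : 1 - a * p ^ i ≠ 0 := ne_zero_of_valuation_eq_one (hap i (mem_range.1 hi))
    have hP : 1 - p * p ^ i ≠ 0 := ne_zero_of_valuation_eq_one (hpp i (mem_range.1 hi))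
    rw [mul_right_comm p u, div_mul_eq_mul_div a u]
    generalize a * p ^ i = Q, p * p ^ i = P at *
    rw [show 1 + (1 - u⁻¹) * (Q / (1 - Q)) = (1 - Q / u) / (1 - Q) by field_simp; ring,
      show 1 + (1 - u⁻¹) * -(1 / (1 - P)) = (1 - P * u) / (u * (1 - P)) by field_simp; ring]
    simp only [div_eq_mul_inv, mul_inv, inv_inv]
    ring
  rw [hproduct]
  refine FirstOrder.prod hε fun i hi => ?_
  have hQ := hap i (mem_range.1 hi)
  have hP := hpp i (mem_range.1 hi)
  have hnumerator : v (a * p ^ i / (1 - a * p ^ i)) ≤ 1 := by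
    rw [map_div₀, hQ, div_one, map_mul, map_pow]
    exact mul_le_one' ha (pow_le_one' hp i)
  have hdenominator : v (-(1 / (1 - p * p ^ i))) ≤ 1 := by
    rw [Valuation.map_neg, map_div₀, hP, map_one, div_one]
  simpa only [neg_neg] using
    (FirstOrder.one_add hnumerator).mul ((FirstOrder.one_add hdenominator).inv hε) hε

theorem ValModEq.sqHarmonic (h : ValModEq v γ x y) (hp : v p ≤ 1)
    (hx : ∀ i < k, v (1 - x * p ^ i) = 1) (hy : ∀ i < k, v (1 - y * p ^ i) = 1) :
    ValModEq v γ (sqHarmonic x p k) (sqHarmonic y p k) :=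
  ValModEq.sum fun i hi => by
    have hi := mem_range.1 hi
    have hpi : v (p ^ i) ≤ 1 := by rw [map_pow]; exact pow_le_one' hp i
    refine (h.mul (ValModEq.refl hpi)).div ((h.one_sub_mul_pow hp i).pow 2) ?_ ?_
    · rw [map_pow, hx i hi, one_pow]
    · rw [map_pow, hy i hi, one_pow]

theorem ValModEq.endCoeff (h : ValModEq v γ x y) (hp : v p ≤ 1)
    (hx : ∀ i < k, v (1 - x * p ^ i) = 1) (hy : ∀ i < k, v (1 - y * p ^ i) = 1)
    (hpp : ∀ i < k, v (1 - p * p ^ i) = 1) :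
    ValModEq v γ (endCoeff x p k) (endCoeff y p k) :=
  ValModEq.sum fun i hi => by
    have hi := mem_range.1 hi
    have hpi : v (p ^ i) ≤ 1 := by rw [map_pow]; exact pow_le_one' hp i
    have hconst : v (-(1 / (1 - p * p ^ i))) ≤ 1 := by
      rw [Valuation.map_neg, map_div₀, hpp i hi, map_one, div_one]
    simpa only [sub_neg_eq_add] using ((h.mul (ValModEq.refl hpi)).div (h.one_sub_mul_pow hp i)
      (hx i hi) (hy i hi)).sub' (ValModEq.refl hconst)

end Valuation

/-! ### Supercongruences at a valuation -/

section NearRootOfUnity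

variable {K : Type*} [Field K] {Γ : Type*} [LinearOrderedCommGroupWithZero Γ]

/-- The base `p` has exact order `m` in the residue field of `v`, where `a` coincides with
`p^(-s)`; the congruences `p^m ≡ 1` and `a p^s ≡ 1` hold modulo `γ`. -/
structure NearRootOfUnity (v : Valuation K Γ) (γ : Γ) (a p : K) (m s : ℕ) : Prop where
  lt_one : γ < 1
  lt : s < m
  val_one_sub_pow : ∀ i, 0 < i → i < m → v (1 - p ^ i) = 1
  near_p : ValModEq v γ (p ^ m) 1
  near_a : ValModEq v γ (a * p ^ s) 1

/-- The factor of `vwpTerm a p (l + t)` that depends on `t`, with `w = p^l`. -/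
def shiftedTerm (a p w : K) (t : ℕ) : K :=
  (1 - a * w ^ 2 * p ^ (2 * t)) * (poch (a * w) p t / poch (p * w) p t) ^ 6 * (p ^ 2 / a ^ 3) ^ t

theorem shiftedTerm_one (a p : K) (t : ℕ) : shiftedTerm a p 1 t = vwpTerm a p t := by
  rw [shiftedTerm, vwpTerm, one_pow, mul_one, mul_one]

theorem vwpTerm_add (a p : K) (l t : ℕ) :
    vwpTerm a p (l + t) =
      (poch a p l / poch p p l) ^ 6 * (p ^ 2 / a ^ 3) ^ l * shiftedTerm a p (p ^ l) t := by
  rw [vwpTerm, shiftedTerm, poch_add, poch_add, pow_add (p ^ 2 / a ^ 3)]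
  simp only [div_eq_mul_inv, mul_inv]
  ring

variable {v : Valuation K Γ} {γ : Γ}

theorem FirstOrder.valuation_sq_mul_le {δ ε ρ ζ α β : K} (hδ : v δ ≤ γ ^ 2) (hε : v ε ≤ γ)
    (hγ : γ < 1) (hρ : FirstOrder v δ ρ α) (hζ : FirstOrder v ε ζ β) :
    v ((1 - ρ) ^ 2 * (1 - ζ) + δ ^ 2 * ε * (α ^ 2 * β)) ≤ γ ^ 6 := by
  have hδα : v (δ * α) ≤ γ ^ 2 := by
    rw [map_mul]; exact (mul_le_of_le_one_right' hρ.coeff).trans hδ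
  have hρ_one : v (ρ - 1) ≤ γ ^ 2 :=
    (hρ.sub_one (hδ.trans_lt (pow_lt_one₀ zero_le hγ two_ne_zero))).trans hδ
  have hζ_one : v (ζ - 1) ≤ 1 := (hζ.sub_one (hε.trans_lt hγ)).trans (hε.trans hγ.le)
  rw [show (1 - ρ) ^ 2 * (1 - ζ) + δ ^ 2 * ε * (α ^ 2 * β) =
    (ρ - 1 - δ * α) * ((ρ - 1) + δ * α) * -(ζ - 1) - (δ * α) ^ 2 * (ζ - 1 - ε * β) by ring]
  refine v.map_sub_le ?_ ?_
  · rw [map_mul, map_mul, Valuation.map_neg]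
    calc
      _ ≤ (γ ^ 2) ^ 2 * γ ^ 2 * 1 := mul_le_mul' (mul_le_mul' (hρ.sub.trans
          (pow_le_pow_left' hδ 2)) (v.map_add_le hρ_one hδα)) hζ_one
      _ = γ ^ 6 := by rw [mul_one, ← pow_mul, ← pow_add]
  · rw [map_mul, map_pow]
    calc
      _ ≤ (γ ^ 2) ^ 2 * γ ^ 2 := mul_le_mul' (pow_le_pow_left' hδα 2)
          (hζ.sub.trans (pow_le_pow_left' hε 2))
      _ = γ ^ 6 := by rw [← pow_mul, ← pow_add]

namespace ValModEq

variable {u x : K}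

theorem valuation_sq_div_le (hu : ValModEq v γ u 1) (hγ : γ < 1) :
    v ((1 - u) ^ 2 / u) ≤ γ ^ 2 := by
  rw [map_div₀, hu.val_eq_one hγ (map_one v), div_one, map_pow]
  exact pow_le_pow_left' hu.symm.sub 2

theorem valuation_sq_div_lt_one (hu : ValModEq v γ u 1) (hγ : γ < 1) :
    v ((1 - u) ^ 2 / u) < 1 :=
  (hu.valuation_sq_div_le hγ).trans_lt (pow_lt_one₀ zero_le hγ two_ne_zero)

theorem valuation_bracket_le {ξ η A B : K} (hu : ValModEq v γ u 1) (hγ : γ < 1)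
    (hξ : FirstOrder v ((1 - u) ^ 2 / u) ξ (-A)) (hη : FirstOrder v ((1 - u) ^ 2 / u) η B) :
    v (ξ * (2 - η) - (1 - (1 - u) ^ 2 * (2 - u) * (B + A))) ≤ γ ^ 4 := by
  have hvu := hu.val_eq_one hγ (map_one v)
  have hδ := hu.valuation_sq_div_lt_one hγ
  have hδ_sq : v ((1 - u) ^ 2 / u) ^ 2 ≤ γ ^ 4 := by
    simpa only [← pow_mul] using pow_le_pow_left' (hu.valuation_sq_div_le hγ) 2
  have hA : v A ≤ 1 := by simpa only [Valuation.map_neg] using hξ.coeff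
  have hexpand : (1 - u) ^ 2 * (2 - u) = (1 - u) ^ 2 / u - (1 - u) ^ 4 / u := by
    have hu₀ := ne_zero_of_valuation_eq_one hvu
    field_simp
    ring
  rw [hexpand]
  set δ := (1 - u) ^ 2 / u
  rw [show ξ * (2 - η) - (1 - (δ - (1 - u) ^ 4 / u) * (B + A)) =
    (ξ - 1 - δ * -A) * (1 - (η - 1)) + (1 + δ * -A) * -(η - 1 - δ * B) + δ * δ * (A * B) -
      (1 - u) ^ 4 / u * (B + A) by ring]
  refine v.map_sub_le (v.map_add_le (v.map_add_le ?_ ?_) ?_) ?_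
  · rw [map_mul]
    exact mul_le_of_le_of_le_one (hξ.sub.trans hδ_sq)
      (v.map_sub_le (map_one v).le ((hη.sub_one hδ).trans hδ.le))
  · rw [map_mul, Valuation.map_neg]
    refine mul_le_of_le_one_of_le (v.map_add_le (map_one v).le ?_) (hη.sub.trans hδ_sq)
    rw [map_mul]
    exact mul_le_one' hδ.le hξ.coeff
  · rw [map_mul, map_mul, map_mul, ← sq]
    exact mul_le_of_le_of_le_one hδ_sq (mul_le_one' hA hη.coeff)
  · rw [map_mul, map_div₀, hvu, div_one, map_pow]
    exact mul_le_of_le_of_le_one (pow_le_pow_left' hu.symm.sub 4) (v.map_add_le hη.coeff hA)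

theorem mul_near (hu : ValModEq v γ u 1) (hx : v x ≤ 1) : ValModEq v γ (x * u) x := by
  simpa only [mul_one] using (ValModEq.refl hx).mul hu

theorem div_near (hu : ValModEq v γ u 1) (hγ : γ < 1) (hx : v x ≤ 1) : ValModEq v γ (x / u) x := by
  simpa only [div_one] using (ValModEq.refl hx).div hu (hu.val_eq_one hγ (map_one v)) (map_one v)

end ValModEq

theorem pairPoch_modEq {u c p : K} {k : ℕ} (hu : ValModEq v γ u 1) (hγ : γ < 1) (hc : v c ≤ 1)
    (hp : v p ≤ 1) (hcp : ∀ i < k, v (1 - c * p ^ i) = 1) :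
    ValModEq v (γ ^ 2) (pairPoch c p u k) (pairPoch c p 1 k) := by
  have hδ := hu.valuation_sq_div_lt_one hγ
  have hexpansion := firstOrder_pairPoch
    (ne_zero_of_valuation_eq_one (hu.val_eq_one hγ (map_one v))) hδ hc hp hcp
  have hvc : v (poch c p k ^ 2) = 1 := by rw [map_pow, valuation_poch_eq_one hcp, one_pow]
  have hratio : ValModEq v (γ ^ 2) (pairPoch c p u k / poch c p k ^ 2) 1 :=
    ⟨(hexpansion.val_eq_one hδ).le, (map_one v).le,
      (hexpansion.sub_one hδ).trans (hu.valuation_sq_div_le hγ)⟩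
  simpa only [pairPoch_one, one_mul, div_mul_cancel₀ _ (ne_zero_of_valuation_eq_one hvc)]
    using hratio.mul (ValModEq.refl hvc.le)

namespace NearRootOfUnity

variable {a p u x w : K} {m s k n : ℕ} (h : NearRootOfUnity v γ a p m s)
include h

theorem val_p : v p = 1 := by
  have hpow := h.near_p.val_eq_one h.lt_one (map_one v)
  rw [map_pow] at hpow
  exact (pow_eq_one_iff_of_nonneg zero_le (Nat.ne_zero_of_lt h.lt)).1 hpow

theorem p_ne_zero : p ≠ 0 := ne_zero_of_valuation_eq_one h.val_p

theorem val_pow (n : ℕ) : v (p ^ n) = 1 := by rw [map_pow, h.val_p, one_pow]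

theorem val_a : v a = 1 := by
  simpa only [map_mul, h.val_pow, mul_one] using h.near_a.val_eq_one h.lt_one (map_one v)

theorem modEq_a : ValModEq v γ a (p ^ s)⁻¹ := by
  have hinv : v (p ^ s)⁻¹ ≤ 1 := by rw [map_inv₀, h.val_pow, inv_one]
  simpa only [mul_assoc, mul_inv_cancel₀ (pow_ne_zero s h.p_ne_zero), mul_one, one_mul]
    using h.near_a.mul (ValModEq.refl hinv)

theorem near_pow_mul (l : ℕ) : ValModEq v γ (p ^ (l * m)) 1 := by
  simpa only [← pow_mul, mul_comm m, one_pow] using h.near_p.pow l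

theorem val_one_sub_p_mul (hx : ValModEq v γ x p) {i : ℕ} (hi : i + 1 < m) :
    v (1 - x * p ^ i) = 1 :=
  (hx.one_sub_mul_pow h.val_p.le i).val_eq_one h.lt_one <| by
    rw [← pow_succ']; exact h.val_one_sub_pow _ i.succ_pos hi

theorem val_one_sub_inv_mul (hx : ValModEq v γ x (p ^ s)⁻¹) {i : ℕ} (hi : i < s) :
    v (1 - x * p ^ i) = 1 := by
  refine (hx.one_sub_mul_pow h.val_p.le i).val_eq_one h.lt_one ?_
  obtain ⟨j, rfl⟩ := Nat.exists_eq_add_of_lt hi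
  have hp := h.p_ne_zero
  rw [show 1 - (p ^ (i + j + 1))⁻¹ * p ^ i = -((p ^ (j + 1))⁻¹ * (1 - p ^ (j + 1))) by
      rw [add_assoc, pow_add]; field_simp; ring,
    Valuation.map_neg, map_mul, map_inv₀, h.val_pow,
    h.val_one_sub_pow _ j.succ_pos (by have := h.lt; omega), inv_one, one_mul]

theorem val_one_sub_a_mul {i : ℕ} (hi : i < s) : v (1 - a * p ^ i) = 1 :=
  h.val_one_sub_inv_mul h.modEq_a hi

theorem val_one_sub_self_mul {i : ℕ} (hi : i < s) : v (1 - p * p ^ i) = 1 :=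
  h.val_one_sub_p_mul (ValModEq.refl h.val_p.le) ((Nat.succ_lt_succ hi).trans_le h.lt)

theorem val_poch_p (hx : ValModEq v γ x p) (hk : k < m) : v (poch x p k) = 1 :=
  valuation_poch_eq_one fun _ hi => h.val_one_sub_p_mul hx ((Nat.succ_lt_succ hi).trans_le hk)

theorem val_poch_self (hk : k < m) : v (poch p p k) = 1 :=
  h.val_poch_p (ValModEq.refl h.val_p.le) hk

theorem val_poch_a (hk : k ≤ s) : v (poch a p k) = 1 :=
  valuation_poch_eq_one fun _ hi => h.val_one_sub_a_mul (hi.trans_le hk)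

theorem isGeneric (hu : a * p ^ s = u) (hu₁ : u ≠ 1) : IsGeneric a p u s where
  mul_pow := hu
  u_ne_zero := ne_zero_of_valuation_eq_one (hu ▸ h.near_a.val_eq_one h.lt_one (map_one v))
  p_ne_zero := h.p_ne_zero
  one_sub_ne_zero := by
    rcases s.eq_zero_or_pos with rfl | hs
    · rw [pow_zero, mul_one] at hu
      exact hu ▸ sub_ne_zero.2 hu₁.symm
    · simpa using ne_zero_of_valuation_eq_one (h.val_one_sub_a_mul hs)
  poch_self_ne_zero := ne_zero_of_valuation_eq_one (h.val_poch_self h.lt)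
  poch_mul_ne_zero := poch_ne_zero_iff.2 fun i hi => by
    rw [mul_assoc, ← pow_succ']
    rcases lt_trichotomy (i + 1) s with hlt | heq | hgt
    · exact ne_zero_of_valuation_eq_one (h.val_one_sub_a_mul hlt)
    · rw [heq, hu]; exact sub_ne_zero.2 hu₁.symm
    · obtain ⟨j, hj⟩ := Nat.exists_eq_add_of_lt hgt
      rw [hj, show a * p ^ (s + j + 1) = p * (a * p ^ s) * p ^ j by ring]
      exact ne_zero_of_valuation_eq_one
        (h.val_one_sub_p_mul (h.near_a.mul_near h.val_p.le) (by have := h.lt; omega))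

theorem shiftedTerm_modEq (hw : ValModEq v γ w 1) (hk : k < m) :
    ValModEq v γ (shiftedTerm a p w k) (vwpTerm (p ^ s)⁻¹ p k) := by
  have ha := h.modEq_a
  have hshift (n : ℕ) : ValModEq v γ (a * w ^ n) (p ^ s)⁻¹ := by
    simpa only [one_pow, mul_one] using ha.mul (hw.pow n)
  have hfactor := (ValModEq.refl (map_one v).le).sub'
    ((hshift 2).mul (ValModEq.refl (h.val_pow (2 * k)).le))
  have hratio := ((pow_one w ▸ hshift 1).poch h.val_p.le k).div
    ((hw.mul_near h.val_p.le).poch h.val_p.le k)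
    (h.val_poch_p (hw.mul_near h.val_p.le) hk) (h.val_poch_self hk)
  have hargument := (ValModEq.refl (h.val_pow 2).le).div (ha.pow 3)
    (by rw [map_pow, h.val_a, one_pow])
    (by rw [map_pow, map_inv₀, h.val_pow, inv_one, one_pow])
  exact (hfactor.mul (hratio.pow 6)).mul (hargument.pow k)

theorem vwpTerm_modEq (hk : k < m) : ValModEq v γ (vwpTerm a p k) (vwpTerm (p ^ s)⁻¹ p k) :=
  shiftedTerm_one a p k ▸ h.shiftedTerm_modEq (ValModEq.refl (map_one v).le) hk

theorem inv_pow_mul_pow : (p ^ s)⁻¹ * p ^ s = 1 := inv_mul_cancel₀ (pow_ne_zero s h.p_ne_zero)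

end NearRootOfUnity

end NearRootOfUnity

section Supercongruence

variable {K : Type*} [Field K] {Γ : Type*} [LinearOrderedCommGroupWithZero Γ]
  {v : Valuation K Γ} {γ : Γ}

theorem ValModEq.valuation_one_sub_inv_le {u : K} (hu : ValModEq v γ u 1) (hγ : γ < 1) :
    v (1 - u⁻¹) ≤ γ := by
  simpa only [inv_one] using (hu.inv (hu.val_eq_one hγ (map_one v)) (map_one v)).symm.sub

theorem mixedDifference_term {a p : K} {k : ℕ} (u : K) (ha : poch a p k ≠ 0)
    (hp : poch p p k ≠ 0) :
    baseTerm a p k * (pairRatio a p 1 k - pairRatio a p u k) ^ 2 *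
        (endRatio a p 1 k - endRatio a p u k) =
      vwpTerm a p k * ((1 - pairRatio a p u k / pairRatio a p 1 k) ^ 2 *
        (1 - endRatio a p u k / endRatio a p 1 k)) := by
  have hend : endRatio a p 1 k ≠ 0 := endRatio_one a p k ▸ div_ne_zero ha hp
  have hpair : pairRatio a p 1 k ≠ 0 := pairRatio_one a p k ▸ pow_ne_zero 2 (div_ne_zero ha hp)
  rw [vwpTerm_eq, one_sub_div hpair, one_sub_div hend]
  field_simp

theorem balancedCoeff_term {a p u : K} {N n : ℕ} (z : K) (ha : poch a p n ≠ 0)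
    (hp : poch p p n ≠ 0) :
    2 * (balancedCoeff a p u N n * (pairPoch a p u n / pairPoch p p 1 n)) -
        balancedCoeff a p u N n * (pairPoch a p u n / pairPoch p p u n) -
        balancedCoeff a p u N n * (poch a p n ^ 2 / poch p p n ^ 2 * z) =
      balancedCoeff a p u N n * (poch a p n ^ 2 / poch p p n ^ 2) *
        (pairPoch a p u n / poch a p n ^ 2 * (2 - (pairPoch p p u n / poch p p n ^ 2)⁻¹) - z) := by
  rw [pairPoch_one, inv_div]
  generalize poch a p n = α, poch p p n = β at *
  field_simp

namespace NearRootOfUnity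

variable {a p u : K} {m s k n : ℕ} (h : NearRootOfUnity v γ a p m s)
include h

theorem pairCoeff_modEq (hk : k ≤ s) :
    ValModEq v γ (pairCoeff a p k) (pairCoeff (p ^ s)⁻¹ p k) :=
  have hself (i) (hi : i < k) := h.val_one_sub_self_mul (hi.trans_le hk)
  ((ValModEq.refl h.val_p.le).sqHarmonic h.val_p.le hself hself).sub'
    (h.modEq_a.sqHarmonic h.val_p.le (fun _ hi => h.val_one_sub_a_mul (hi.trans_le hk))
      fun _ hi => h.val_one_sub_inv_mul (ValModEq.refl h.modEq_a.right) (hi.trans_le hk))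

theorem endCoeff_modEq (hk : k ≤ s) :
    ValModEq v γ (endCoeff a p k) (endCoeff (p ^ s)⁻¹ p k) :=
  h.modEq_a.endCoeff h.val_p.le (fun _ hi => h.val_one_sub_a_mul (hi.trans_le hk))
    (fun _ hi => h.val_one_sub_inv_mul (ValModEq.refl h.modEq_a.right) (hi.trans_le hk))
    fun _ hi => h.val_one_sub_self_mul (hi.trans_le hk)

theorem val_sum_vwpTerm_mul_coeff_le [CharZero K] :
    v (∑ k ∈ range (s + 1), vwpTerm a p k * (pairCoeff a p k ^ 2 * endCoeff a p k)) ≤ γ := by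
  have hreduction := ValModEq.sum (s := range (s + 1)) fun k hk =>
    have hk : k ≤ s := mem_range_succ_iff.1 hk
    (h.vwpTerm_modEq (hk.trans_lt h.lt)).mul
      (((h.pairCoeff_modEq hk).pow 2).mul (h.endCoeff_modEq hk))
  simpa only [sum_vwpTerm_mul_coeff_eq_zero h.p_ne_zero h.inv_pow_mul_pow
    (ne_zero_of_valuation_eq_one (h.val_poch_self h.lt)), sub_zero] using hreduction.sub

theorem val_mixedDifference_sub_le [CharZero K] (hu : ValModEq v γ u 1) :
    v (mixedDifference a p s u fun k => endRatio a p 1 k - endRatio a p u k) ≤ γ ^ 6 := by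
  have hγ := h.lt_one
  have hu₀ := ne_zero_of_valuation_eq_one (hu.val_eq_one hγ (map_one v))
  set δ := (1 - u) ^ 2 / u
  set ε := 1 - u⁻¹
  have hδ : v δ ≤ γ ^ 2 := hu.valuation_sq_div_le hγ
  have hε : v ε ≤ γ := hu.valuation_one_sub_inv_le hγ
  have hterm : ∀ k ∈ range (s + 1), baseTerm a p k * (pairRatio a p 1 k - pairRatio a p u k) ^ 2 *
      (endRatio a p 1 k - endRatio a p u k) = vwpTerm a p k *
        ((1 - pairRatio a p u k / pairRatio a p 1 k) ^ 2 *
          (1 - endRatio a p u k / endRatio a p 1 k) +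
            δ ^ 2 * ε * (pairCoeff a p k ^ 2 * endCoeff a p k)) -
      δ ^ 2 * ε * (vwpTerm a p k * (pairCoeff a p k ^ 2 * endCoeff a p k)) := fun k hk => by
    have hk := mem_range_succ_iff.1 hk
    rw [mixedDifference_term u (ne_zero_of_valuation_eq_one (h.val_poch_a hk))
      (ne_zero_of_valuation_eq_one (h.val_poch_self (hk.trans_lt h.lt)))]
    ring
  rw [mixedDifference, sum_congr rfl hterm, sum_sub_distrib, ← mul_sum]
  refine v.map_sub_le (v.map_sum_le fun k hk => ?_) ?_
  · have hk := mem_range_succ_iff.1 hk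
    have hpp (i) (hi : i < k) := h.val_one_sub_self_mul (hi.trans_le hk)
    have hap (i) (hi : i < k) := h.val_one_sub_a_mul (hi.trans_le hk)
    rw [map_mul]
    exact mul_le_of_le_one_of_le (h.vwpTerm_modEq (hk.trans_lt h.lt)).left
      (FirstOrder.valuation_sq_mul_le hδ hε hγ
        (firstOrder_pairRatio hu₀ (hu.valuation_sq_div_lt_one hγ) h.val_a.le h.val_p.le hap hpp)
        (firstOrder_endRatio hu₀ (hε.trans_lt hγ) h.val_a.le h.val_p.le hap hpp))
  · rw [map_mul, map_mul, map_pow]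
    calc
      _ ≤ (γ ^ 2) ^ 2 * γ * γ :=
        mul_le_mul' (mul_le_mul' (pow_le_pow_left' hδ 2) hε) h.val_sum_vwpTerm_mul_coeff_le
      _ = γ ^ 6 := by rw [← pow_mul, ← pow_succ, ← pow_succ]

theorem val_poch_p_div_a_le_one (k : ℕ) : v (poch (p / a) p k) ≤ 1 :=
  valuation_poch_le_one (by rw [map_div₀, h.val_p, h.val_a, div_one]) h.val_p.le k

theorem val_poch_p_div_a_le (hk : m ≤ s + k) : v (poch (p / a) p k) ≤ γ := by
  have hp₀ := h.p_ne_zero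
  have ha₀ : a ≠ 0 := ne_zero_of_valuation_eq_one h.val_a
  obtain ⟨j, hj⟩ := Nat.exists_eq_add_of_lt h.lt
  have hfactor : p / a * p ^ j = p ^ m / (a * p ^ s) := by rw [hj]; field_simp; ring
  have hnear : ValModEq v γ (p ^ m / (a * p ^ s)) 1 := by
    simpa only [div_one] using h.near_p.div h.near_a
      (h.near_a.val_eq_one h.lt_one (map_one v)) (map_one v)
  exact valuation_poch_le_of_factor (i := j) (by rw [map_div₀, h.val_p, h.val_a, div_one])
    h.val_p.le (by omega) (hfactor ▸ hnear.symm.sub)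

theorem val_poch_sq_le (hms : 2 * m ≤ 3 * s + 1) (hmsn : s + n < m) :
    v (poch (a ^ 2 * p ^ n) p (s - n)) ≤ γ := by
  obtain ⟨j, hj⟩ := Nat.exists_eq_add_of_le (show m + n ≤ 2 * s by omega)
  have hfactor : a ^ 2 * p ^ n * p ^ j = a * p ^ s * (a * p ^ s) / p ^ m := by
    rw [eq_div_iff (pow_ne_zero m h.p_ne_zero)]
    calc
      _ = a ^ 2 * p ^ (m + n + j) := by ring
      _ = a * p ^ s * (a * p ^ s) := by rw [← hj]; ring
  have hnear : ValModEq v γ (a * p ^ s * (a * p ^ s) / p ^ m) 1 := by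
    simpa only [mul_one, div_one] using (h.near_a.mul h.near_a).div h.near_p
      (h.val_pow m) (map_one v)
  exact valuation_poch_le_of_factor (i := j) (by rw [map_mul, map_pow, h.val_a, h.val_pow]; simp)
    h.val_p.le (by omega) (hfactor ▸ hnear.symm.sub)

theorem val_balancedCoeff_le (hms : 2 * m ≤ 3 * s + 1) (hu : ValModEq v γ u 1) (hn : n ≤ s) :
    v (balancedCoeff a p u s n) ≤ γ ^ 2 := by
  have hpoch : v (poch (a ^ 2 * p ^ n) p (s - n)) * v (poch (p / a) p n) ≤ γ := by
    rcases le_or_gt m (s + n) with hmn | hmn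
    · exact mul_le_of_le_one_of_le (valuation_poch_le_one
        (by rw [map_mul, map_pow, h.val_a, h.val_pow]; simp) h.val_p.le _)
        (h.val_poch_p_div_a_le hmn)
    · exact mul_le_of_le_of_le_one (h.val_poch_sq_le hms hmn) (h.val_poch_p_div_a_le_one n)
  simp only [balancedCoeff, map_mul, map_div₀, map_inv₀, map_pow, h.val_p, h.val_a,
    h.val_poch_self h.lt, h.val_poch_self (hn.trans_lt h.lt), h.val_poch_a hn, one_pow, inv_one,
    mul_one, div_one]
  rw [mul_assoc, sq γ]
  exact mul_le_mul' hu.symm.sub hpoch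

theorem val_balancedCoeff'_le (hms : 2 * m ≤ 3 * s + 1) (hu : ValModEq v γ u 1) (hn : n ≤ s) :
    v (balancedCoeff' a p u s n) ≤ γ ^ 2 := by
  have hpoch : v (poch (p / a) p (s - n)) * v (poch (p / a) p n) ≤ γ := by
    rcases le_or_gt m (s + n) with hmn | hmn
    · exact mul_le_of_le_one_of_le (h.val_poch_p_div_a_le_one _) (h.val_poch_p_div_a_le hmn)
    · exact mul_le_of_le_of_le_one (h.val_poch_p_div_a_le (by omega))
        (h.val_poch_p_div_a_le_one n)
  simp only [balancedCoeff', map_mul, map_div₀, map_pow, h.val_p, h.val_a,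
    h.val_poch_self h.lt, h.val_poch_self (hn.trans_lt h.lt),
    h.val_poch_self ((s.sub_le n).trans_lt h.lt), h.val_poch_a le_rfl, one_pow, mul_one, div_one,
    one_mul]
  rw [mul_assoc, sq γ]
  exact mul_le_mul' hu.symm.sub hpoch

theorem pairPoch_self_modEq (hu : ValModEq v γ u 1) (hn : n ≤ s) :
    ValModEq v (γ ^ 2) (pairPoch p p u n) (pairPoch p p 1 n) :=
  pairPoch_modEq hu h.lt_one h.val_p.le h.val_p.le
    fun _ hi => h.val_one_sub_self_mul (hi.trans_le hn)

theorem pairPoch_a_modEq (hu : ValModEq v γ u 1) (hn : n ≤ s) :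
    ValModEq v (γ ^ 2) (pairPoch a p u n) (pairPoch a p 1 n) :=
  pairPoch_modEq hu h.lt_one h.val_a.le h.val_p.le
    fun _ hi => h.val_one_sub_a_mul (hi.trans_le hn)

theorem val_pairPoch_one (hn : n ≤ s) : v (pairPoch p p 1 n) = 1 := by
  rw [pairPoch_one, map_pow, h.val_poch_self (hn.trans_lt h.lt), one_pow]

theorem val_pairPoch_self (hu : ValModEq v γ u 1) (hn : n ≤ s) : v (pairPoch p p u n) = 1 :=
  (h.pairPoch_self_modEq hu hn).val_eq_one (pow_lt_one₀ zero_le h.lt_one two_ne_zero)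
    (h.val_pairPoch_one hn)

theorem val_mixedDifference_le (hms : 2 * m ≤ 3 * s + 1) (hgen : IsGeneric a p u s) :
    v (mixedDifference a p s u (endRatio a p u)) ≤ γ ^ 6 := by
  have hu : ValModEq v γ u 1 := hgen.mul_pow ▸ h.near_a
  have hone := ne_zero_of_valuation_eq_one (h.val_pairPoch_one le_rfl)
  have hself := ne_zero_of_valuation_eq_one (h.val_pairPoch_self hu le_rfl)
  have hseries : mixedDifference a p s u (endRatio a p u) =
      ∑ n ∈ range (s + 1), balancedCoeff' a p u s n *
        ((pairPoch a p u n / pairPoch p p u s - pairPoch a p 1 n / pairPoch p p 1 s) *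
          ((pairPoch p p u n)⁻¹ - (pairPoch p p 1 n)⁻¹)) := by
    rw [mixedDifference_eq, hgen.wellPoisedSum_self one_ne_zero one_ne_zero hone hone,
      hgen.wellPoisedSum_self one_ne_zero hgen.u_ne_zero hone hself,
      hgen.wellPoisedSum_self hgen.u_ne_zero one_ne_zero hself hone,
      hgen.wellPoisedSum_self hgen.u_ne_zero hgen.u_ne_zero hself hself]
    simp only [← sum_sub_distrib, ← sum_add_distrib]
    exact sum_congr rfl fun n _ => by ring
  rw [hseries]
  refine v.map_sum_le fun n hn => ?_
  have hn := mem_range_succ_iff.1 hn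
  rw [map_mul, map_mul, show γ ^ 6 = γ ^ 2 * (γ ^ 2 * γ ^ 2) by rw [← pow_add, ← pow_add]]
  exact mul_le_mul' (h.val_balancedCoeff'_le hms hu hn) (mul_le_mul'
    ((h.pairPoch_a_modEq hu hn).div (h.pairPoch_self_modEq hu le_rfl)
      (h.val_pairPoch_self hu le_rfl) (h.val_pairPoch_one le_rfl)).sub
    ((h.pairPoch_self_modEq hu hn).inv (h.val_pairPoch_self hu hn) (h.val_pairPoch_one hn)).sub)

theorem val_wellPoisedSum_sub_balancedSide_le (hms : 2 * m ≤ 3 * s + 1)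
    (hgen : IsGeneric a p u s) (ha : poch (a ^ 2) p s ≠ 0) :
    v (2 * wellPoisedSum a p s u 1 1 - wellPoisedSum a p s u u 1 - balancedSide a p u s) ≤
      γ ^ 6 := by
  have hγ := h.lt_one
  have hu : ValModEq v γ u 1 := hgen.mul_pow ▸ h.near_a
  have hpu : poch (p / u) p s ≠ 0 :=
    ne_zero_of_valuation_eq_one (h.val_poch_p (hu.div_near hγ h.val_p.le) h.lt)
  rw [hgen.wellPoisedSum_one one_ne_zero
      (ne_zero_of_valuation_eq_one (h.val_pairPoch_one le_rfl)) hpu,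
    hgen.wellPoisedSum_one hgen.u_ne_zero
      (ne_zero_of_valuation_eq_one (h.val_pairPoch_self hu le_rfl)) hpu,
    balancedSide_eq u ha, mul_sum, ← sum_sub_distrib, ← sum_sub_distrib]
  refine v.map_sum_le fun n hn => ?_
  have hn := mem_range_succ_iff.1 hn
  have hva := h.val_poch_a hn
  have hvp := h.val_poch_self (hn.trans_lt h.lt)
  have hδ := hu.valuation_sq_div_lt_one hγ
  have hξ := firstOrder_pairPoch (k := n) hgen.u_ne_zero hδ h.val_a.le h.val_p.le
    fun _ hi => h.val_one_sub_a_mul (hi.trans_le hn)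
  have hη := (firstOrder_pairPoch (k := n) hgen.u_ne_zero hδ h.val_p.le h.val_p.le
    fun _ hi => h.val_one_sub_self_mul (hi.trans_le hn)).inv hδ
  rw [neg_neg] at hη
  have hbracket := hu.valuation_bracket_le hγ hξ hη
  rw [balancedCoeff_term _ (ne_zero_of_valuation_eq_one hva) (ne_zero_of_valuation_eq_one hvp),
    map_mul, map_mul, show γ ^ 6 = γ ^ 2 * 1 * γ ^ 4 by rw [mul_one, ← pow_add]]
  refine mul_le_mul' (mul_le_mul' (h.val_balancedCoeff_le hms hu hn) ?_) hbracket
  rw [map_div₀, map_pow, map_pow, hva, hvp, div_self (pow_ne_zero 2 one_ne_zero)]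

theorem val_vwpTerm_le (hs : s < k) (hk : k < m) : v (vwpTerm a p k) ≤ γ ^ 6 := by
  have hpoch : v (poch a p k) ≤ γ :=
    valuation_poch_le_of_factor h.val_a.le h.val_p.le hs h.near_a.symm.sub
  have hfactor : v (1 - a * p ^ (2 * k)) ≤ 1 :=
    ((ValModEq.refl (γ := γ) h.val_a.le).one_sub_mul_pow h.val_p.le _).left
  rw [vwpTerm, map_mul, map_mul]
  refine mul_le_of_le_of_le_one (mul_le_of_le_one_of_le hfactor ?_) ?_
  · rw [map_pow, map_div₀, h.val_poch_self hk, div_one]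
    exact pow_le_pow_left' hpoch 6
  · simp only [map_pow, map_div₀, h.val_p, h.val_a, one_pow, div_one, le_rfl]

theorem val_sum_vwpTerm_sub_balancedSide_le [CharZero K] (hms : 2 * m ≤ 3 * s + 1)
    (hu : a * p ^ s = u) (hu₁ : u ≠ 1) (ha : poch (a ^ 2) p s ≠ 0) {t : ℕ} (hst : s < t)
    (htm : t ≤ m) :
    v (∑ k ∈ range t, vwpTerm a p k - balancedSide a p u s) ≤ γ ^ 6 := by
  have hgen := h.isGeneric hu hu₁
  rw [← sum_range_add_sum_Ico _ (Nat.succ_le_of_lt hst), sum_vwpTerm_eq_wellPoisedSum a p s u,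
    add_sub_right_comm, add_sub_right_comm]
  refine v.map_add_le (v.map_add_le (h.val_wellPoisedSum_sub_balancedSide_le hms hgen ha)
    (v.map_add_le (h.val_mixedDifference_le hms hgen)
      (h.val_mixedDifference_sub_le (hu ▸ h.near_a)))) (v.map_sum_le fun k hk => ?_)
  have hk := mem_Ico.1 hk
  exact h.val_vwpTerm_le (Nat.lt_of_succ_le hk.1) (hk.2.trans_le htm)

theorem vwpTerm_inv_eq_zero (hk : s < k) : vwpTerm (p ^ s)⁻¹ p k = 0 := by
  have hpoch : poch (p ^ s)⁻¹ p k = 0 :=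
    prod_eq_zero (mem_range.2 hk) (by rw [h.inv_pow_mul_pow, sub_self])
  rw [vwpTerm, hpoch, zero_div, zero_pow (by norm_num), mul_zero, zero_mul]

variable (hreg : ∀ l, v (poch a p (l * m) / poch p p (l * m)) ≤ 1)
include hreg

theorem val_sum_vwpTerm_block_le [CharZero K] (l : ℕ) {t : ℕ} (hs : s < t) (ht : t ≤ m) :
    v (∑ i ∈ range t, vwpTerm a p (l * m + i)) ≤ γ := by
  simp only [vwpTerm_add, ← mul_sum, map_mul]
  refine mul_le_of_le_one_of_le (mul_le_one' ?_ ?_) ?_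
  · rw [map_pow]; exact pow_le_one' (hreg l) 6
  · simp only [map_pow, map_div₀, h.val_p, h.val_a, one_pow, div_one, le_rfl]
  · have hreduction := ValModEq.sum (s := range t) fun i hi =>
      h.shiftedTerm_modEq (h.near_pow_mul l) ((mem_range.1 hi).trans_le ht)
    have hsum : ∑ i ∈ range t, vwpTerm (p ^ s)⁻¹ p i = 0 := by
      rw [← sum_subset (range_subset_range.2 hs) fun i _ hi =>
        h.vwpTerm_inv_eq_zero (not_lt.1 fun hlt => hi (mem_range.2 hlt))]
      simpa only [mul_one] using sum_vwpTerm_mul_eq_zero h.p_ne_zero h.inv_pow_mul_pow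
        (ne_zero_of_valuation_eq_one (h.val_poch_self h.lt)) (φ := fun _ => 1) fun _ _ => rfl
    simpa only [hsum, sub_zero] using hreduction.sub

theorem val_sum_vwpTerm_mul_le [CharZero K] (l : ℕ) :
    v (∑ k ∈ range (l * m), vwpTerm a p k) ≤ γ := by
  induction l with
  | zero => simp
  | succ l ih =>
    rw [add_mul, one_mul, sum_range_add]
    exact v.map_add_le ih (h.val_sum_vwpTerm_block_le hreg l h.lt le_rfl)

theorem val_sum_vwpTerm_mul_add_le [CharZero K] (l : ℕ) :
    v (∑ k ∈ range (l * m + (s + 1)), vwpTerm a p k) ≤ γ := by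
  rw [sum_range_add]
  exact v.map_add_le (h.val_sum_vwpTerm_mul_le hreg l)
    (h.val_sum_vwpTerm_block_le hreg l s.lt_succ_self h.lt)

end NearRootOfUnity

end Supercongruence

/-! ### Cyclotomic valuations of `ℚ(q)` -/

section Cyclotomic

open Polynomial

/-- The prime of `ℚ[q]` generated by the cyclotomic polynomial `Φ_m`. -/
noncomputable def cycPrime (m : ℕ) [NeZero m] : IsDedekindDomain.HeightOneSpectrum ℚ[X] where
  asIdeal := Ideal.span {cyclotomic m ℚ}
  isPrime := (Ideal.span_singleton_prime (cyclotomic_ne_zero m ℚ)).2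
    (cyclotomic.irreducible_rat (NeZero.pos m)).prime
  ne_bot := by simpa using cyclotomic_ne_zero m ℚ

/-- The valuation of `ℚ(q)` attached to the cyclotomic polynomial `Φ_m`. -/
noncomputable def cycVal (m : ℕ) [NeZero m] :
    Valuation (RatFunc ℚ) (WithZero (Multiplicative ℤ)) :=
  (cycPrime m).valuation (RatFunc ℚ)

/-- The valuation of a uniformizer. -/
def unif : WithZero (Multiplicative ℤ) := WithZero.exp (-1)

theorem unif_lt_one : unif < 1 := by
  rw [unif, ← WithZero.exp_zero]; exact WithZero.exp_lt_exp.2 (by norm_num)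

theorem unif_pos : 0 < unif := WithZero.exp_pos

theorem q_ne_zero : (q : RatFunc ℚ) ≠ 0 := RatFunc.X_ne_zero

variable {m : ℕ} [NeZero m]

theorem cycVal_le_pow_iff (f : ℚ[X]) (k : ℕ) :
    cycVal m (algebraMap ℚ[X] (RatFunc ℚ) f) ≤ unif ^ k ↔ cyclotomic m ℚ ^ k ∣ f := by
  have hunif : unif ^ k = WithZero.exp (-(k : ℤ)) := by
    rw [unif, ← WithZero.exp_nsmul, smul_neg, nsmul_one]
  rw [cycVal, IsDedekindDomain.HeightOneSpectrum.valuation_of_algebraMap, hunif,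
    IsDedekindDomain.HeightOneSpectrum.intValuation_le_pow_iff_dvd, cycPrime,
    Ideal.span_singleton_pow, Ideal.dvd_span_singleton, Ideal.mem_span_singleton]

theorem cycVal_eq_one {f : ℚ[X]} (hf : ¬ cyclotomic m ℚ ∣ f) :
    cycVal m (algebraMap ℚ[X] (RatFunc ℚ) f) = 1 := by
  refine ((cycVal_le_pow_iff f 0).2 (one_dvd f)).antisymm (not_lt.1 fun hlt => hf ?_)
  rwa [cycVal, IsDedekindDomain.HeightOneSpectrum.valuation_of_algebraMap, pow_zero,
    IsDedekindDomain.HeightOneSpectrum.intValuation_lt_one_iff_dvd, cycPrime,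
    Ideal.dvd_span_singleton, Ideal.mem_span_singleton] at hlt

theorem cycVal_cyclotomic_self :
    cycVal m (algebraMap ℚ[X] (RatFunc ℚ) (cyclotomic m ℚ)) = unif := by
  rw [cycVal, IsDedekindDomain.HeightOneSpectrum.valuation_of_algebraMap]
  exact IsDedekindDomain.HeightOneSpectrum.intValuation_singleton _ (cyclotomic_ne_zero m ℚ) rfl

theorem cycVal_cyclotomic_of_ne {e : ℕ} (hne : e ≠ m) :
    cycVal m (algebraMap ℚ[X] (RatFunc ℚ) (cyclotomic e ℚ)) = 1 :=
  cycVal_eq_one fun hdvd => (cyclotomic.irreducible_rat (NeZero.pos m)).not_isUnit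
    ((cyclotomic.isCoprime_rat hne).isUnit_of_dvd' hdvd dvd_rfl)

theorem cycVal_q_pow_sub_one {j : ℕ} (hj : 0 < j) :
    cycVal m (q ^ j - 1) = if m ∣ j then unif else 1 := by
  have hpoly : (q ^ j - 1 : RatFunc ℚ) = algebraMap ℚ[X] (RatFunc ℚ) (X ^ j - 1) := by
    rw [map_sub, map_pow, map_one, RatFunc.algebraMap_X]
  rw [hpoly, ← prod_cyclotomic_eq_X_pow_sub_one hj, map_prod, map_prod]
  split_ifs with hmj
  · rw [← mul_prod_erase _ _ (Nat.mem_divisors.2 ⟨hmj, hj.ne'⟩), cycVal_cyclotomic_self,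
      prod_eq_one fun e he => cycVal_cyclotomic_of_ne (mem_erase.1 he).1, mul_one]
  · exact prod_eq_one fun e he => cycVal_cyclotomic_of_ne <| by
      rintro rfl; exact hmj (Nat.dvd_of_mem_divisors he)

theorem cycVal_q : cycVal m q = 1 := by
  rw [show (q : RatFunc ℚ) = algebraMap ℚ[X] (RatFunc ℚ) X from RatFunc.algebraMap_X.symm]
  refine cycVal_eq_one fun hdvd => (cyclotomic.irreducible_rat (NeZero.pos m)).not_isUnit ?_
  have hone := (hdvd.trans (dvd_pow_self X (NeZero.ne m))).sub (cyclotomic.dvd_X_pow_sub_one m ℚ)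
  exact isUnit_of_dvd_one (by simpa only [sub_sub_cancel] using hone)

theorem cycVal_q_zpow (j : ℤ) : cycVal m (q ^ j) = 1 := by rw [map_zpow₀, cycVal_q, one_zpow]

theorem cycVal_q_pow (j : ℕ) : cycVal m (q ^ j) = 1 := by rw [map_pow, cycVal_q, one_pow]

theorem cycVal_one_sub_q_zpow {j : ℤ} (hj : j ≠ 0) :
    cycVal m (1 - q ^ j) = if (m : ℤ) ∣ j then unif else 1 := by
  obtain ⟨k, rfl | rfl⟩ := j.eq_nat_or_neg
  · rw [Valuation.map_sub_swap, zpow_natCast, cycVal_q_pow_sub_one (by omega)]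
    simp only [Int.natCast_dvd_natCast]
  · have hq : (q : RatFunc ℚ) ^ k ≠ 0 := pow_ne_zero _ q_ne_zero
    rw [show (1 - q ^ (-(k : ℤ)) : RatFunc ℚ) = q ^ (-(k : ℤ)) * (q ^ k - 1) by
        rw [zpow_neg, zpow_natCast]; field_simp,
      map_mul, cycVal_q_zpow, one_mul, cycVal_q_pow_sub_one (by omega)]
    simp only [dvd_neg, Int.natCast_dvd_natCast]

theorem cycVal_one_sub_q_zpow_le {j : ℤ} (hj : (m : ℤ) ∣ j) : cycVal m (1 - q ^ j) ≤ unif := by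
  rcases eq_or_ne j 0 with rfl | hj₀
  · simp
  · rw [cycVal_one_sub_q_zpow hj₀, if_pos hj]

theorem cycVal_one_sub_q_zpow_eq_one {j : ℤ} (hj : ¬ (m : ℤ) ∣ j) : cycVal m (1 - q ^ j) = 1 := by
  rw [cycVal_one_sub_q_zpow (by rintro rfl; exact hj (dvd_zero _)), if_neg hj]

theorem unif_le_cycVal_one_sub_q_zpow {j : ℤ} (hj : j ≠ 0) : unif ≤ cycVal m (1 - q ^ j) := by
  rw [cycVal_one_sub_q_zpow hj]
  split_ifs
  exacts [le_rfl, unif_lt_one.le]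

theorem one_sub_q_zpow_ne_zero {j : ℤ} (hj : j ≠ 0) : (1 - q ^ j : RatFunc ℚ) ≠ 0 :=
  (cycVal 1).ne_zero_iff.1 (unif_pos.trans_le (unif_le_cycVal_one_sub_q_zpow hj)).ne'

variable {D : RatFunc ℚ}

theorem cycVal_num (D : RatFunc ℚ) :
    cycVal m (algebraMap ℚ[X] (RatFunc ℚ) D.num) =
      cycVal m D * cycVal m (algebraMap ℚ[X] (RatFunc ℚ) D.denom) := by
  rw [← map_mul, ← (eq_div_iff (RatFunc.algebraMap_ne_zero D.denom_ne_zero)).1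
    (RatFunc.num_div_denom D).symm]

theorem cyclotomic_not_dvd_denom (hD : cycVal m D ≤ 1) : ¬ cyclotomic m ℚ ∣ D.denom := by
  intro hdenom
  have hnum : cyclotomic m ℚ ∣ D.num := by
    rw [← pow_one (cyclotomic m ℚ), ← cycVal_le_pow_iff] at hdenom ⊢
    exact cycVal_num (m := m) D ▸ mul_le_of_le_one_of_le hD hdenom
  exact (cyclotomic.irreducible_rat (NeZero.pos m)).not_isUnit
    ((RatFunc.isCoprime_num_denom D).isUnit_of_dvd' hnum hdenom)

theorem cyclotomic_pow_dvd_num {k : ℕ} (hD : cycVal m D ≤ unif ^ k) :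
    cyclotomic m ℚ ^ k ∣ D.num := by
  have hdenom := cyclotomic_not_dvd_denom (hD.trans (pow_le_one' unif_lt_one.le k))
  rwa [← cycVal_le_pow_iff, cycVal_num, cycVal_eq_one hdenom, mul_one]

omit [NeZero m] in
theorem ratCongr_prod_cyclotomic {s : Finset ℕ} {e : ℕ → ℕ} {A B : RatFunc ℚ}
    (hs : ∀ m ∈ s, m ≠ 0)
    (h : ∀ m ∈ s, ∀ [NeZero m], cycVal m (A - B) ≤ unif ^ e m) :
    RatCongr (∏ m ∈ s, cyclotomic m ℚ ^ e m) A B := by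
  have hnum : ∏ m ∈ s, cyclotomic m ℚ ^ e m ∣ (A - B).num :=
    Finset.prod_dvd_of_coprime (fun i _ j _ hij => (cyclotomic.isCoprime_rat hij).pow)
      fun m hm => have : NeZero m := ⟨hs m hm⟩; cyclotomic_pow_dvd_num (h m hm)
  obtain ⟨w, hw⟩ := hnum
  refine ⟨w, (A - B).denom, IsCoprime.prod_right fun m hm => IsCoprime.pow_right ?_, ?_⟩
  · have : NeZero m := ⟨hs m hm⟩
    exact ((cyclotomic.irreducible_rat (NeZero.pos m)).coprime_iff_not_dvd.2
      (cyclotomic_not_dvd_denom ((h m hm).trans (pow_le_one' unif_lt_one.le _)))).symm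
  · rw [← hw, RatFunc.num_div_denom]

theorem modulus_eq_prod_cyclotomic {n : ℕ} (hn : 1 < n) :
    modulus n = ∏ m ∈ n.divisors.erase 1, cyclotomic m ℚ ^ if m = n then 6 else 1 := by
  have hmem : n ∈ n.divisors.erase 1 :=
    mem_erase.2 ⟨hn.ne', Nat.mem_divisors_self n (by omega)⟩
  rw [modulus, qIntPoly, ← prod_cyclotomic_eq_geom_sum (by omega), ← mul_prod_erase _ _ hmem,
    ← mul_prod_erase _ (fun m => cyclotomic m ℚ ^ if m = n then 6 else 1) hmem, if_pos rfl,
    mul_right_comm, ← pow_succ']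
  exact congrArg _ (prod_congr rfl fun m hm => by rw [if_neg (mem_erase.1 hm).1, pow_one])

theorem ratCongr_modulus {n : ℕ} [NeZero n] (hn : 1 < n) {A B : RatFunc ℚ}
    (htop : cycVal n (A - B) ≤ unif ^ 6)
    (hdvd : ∀ m [NeZero m], 1 < m → m ∣ n → cycVal m (A - B) ≤ unif) :
    RatCongr (modulus n) A B := by
  rw [modulus_eq_prod_cyclotomic hn]
  refine ratCongr_prod_cyclotomic
    (fun m hm => (Nat.pos_of_mem_divisors (mem_of_mem_erase hm)).ne') fun m hm hm₀ => ?_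
  split_ifs with hmn
  · subst hmn; exact htop
  · obtain ⟨hm₁, hm⟩ := mem_erase.1 hm
    rw [pow_one]
    exact hdvd m (by have := NeZero.pos m; omega) (Nat.dvd_of_mem_divisors hm)

end Cyclotomic

/-! ### The two sides as basic hypergeometric sums -/

section Translation

theorem zpow_mul_pow (s : ℤ) (d i : ℕ) : (q ^ s * (q ^ d) ^ i : RatFunc ℚ) = q ^ (s + d * i) := by
  rw [zpow_add₀ q_ne_zero, zpow_mul, zpow_natCast, zpow_natCast]

theorem pow_mul_pow_eq_zpow (d i : ℕ) :
    (q ^ d * (q ^ d) ^ i : RatFunc ℚ) = q ^ ((d : ℤ) * (i + 1 : ℕ)) := by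
  rw [← pow_succ', zpow_mul, zpow_natCast, zpow_natCast]

theorem zpow_two_mul (r : ℤ) : (q ^ (2 * r) : RatFunc ℚ) = (q ^ r) ^ 2 := by
  rw [mul_comm, zpow_mul, zpow_ofNat]

theorem lhsSum_eq (d : ℕ) (r : ℤ) (M : ℕ) :
    lhsSum d r M = (1 - q)⁻¹ * ∑ k ∈ range (M + 1), vwpTerm (q ^ r) (q ^ d : RatFunc ℚ) k := by
  rw [lhsSum, mul_sum]
  refine sum_congr rfl fun k _ => ?_
  have hnum : (q ^ (2 * (d : ℤ) * k + r) : RatFunc ℚ) = q ^ r * (q ^ d) ^ (2 * k) := by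
    rw [zpow_mul_pow]; congr 1; push_cast; ring
  have harg : (q ^ ((2 * (d : ℤ) - 3 * r) * k) : RatFunc ℚ) = ((q ^ d) ^ 2 / (q ^ r) ^ 3) ^ k := by
    rw [zpow_mul, zpow_natCast, zpow_sub₀ q_ne_zero, zpow_two_mul, zpow_natCast, mul_comm 3 r,
      zpow_mul, zpow_ofNat]
  rw [qInt, hnum, harg, vwpTerm, div_pow]
  change _ / _ * (poch _ _ k ^ 6 / poch _ _ k ^ 6) * _ = _
  ring

theorem innerSum_eq (d : ℕ) (r : ℤ) (k : ℕ) :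
    innerSum d r k =
      (1 - q) ^ 2 * (sqHarmonic (q ^ d) (q ^ d) k + sqHarmonic (q ^ r) (q ^ d) k) := by
  rw [innerSum, ← Finset.Ico_add_one_right_eq_Icc, sum_Ico_eq_sum_range, Nat.add_sub_cancel,
    sqHarmonic, sqHarmonic, ← sum_add_distrib, mul_sum]
  refine sum_congr rfl fun i _ => ?_
  rw [pow_mul_pow_eq_zpow, zpow_mul_pow, qInt, qInt, div_pow, div_pow, add_comm 1 i,
    show (d : ℤ) * (i + 1 : ℕ) - d + r = r + d * i by push_cast; ring, div_div_eq_mul_div,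
    div_div_eq_mul_div]
  ring

theorem rhs_eq {n d : ℕ} {r : ℤ} (hd : 0 < d)
    (hN : (d : ℤ) * topIndex n d r = d * n - n - r) :
    qInt (d * n - n) * q ^ (r * (r + n - d * n) / d)
        * (qPoch (q ^ (2 * r)) (q ^ d) (topIndex n d r)
            / qPoch (q ^ d) (q ^ d) (topIndex n d r))
        * ∑ k ∈ range (topIndex n d r + 1),
            (qPoch (q ^ r) (q ^ d) k ^ 3 * qPoch (q ^ ((d : ℤ) - r)) (q ^ d) k
                * q ^ ((d : ℤ) * k))
              / (qPoch (q ^ d) (q ^ d) k ^ 3 * qPoch (q ^ (2 * r)) (q ^ d) k)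
            * (1 - qInt (d * n - n) ^ 2 * (2 - q ^ ((d : ℤ) * n - n)) * innerSum d r k) =
      (1 - q)⁻¹ * balancedSide (q ^ r) (q ^ d) (q ^ ((d : ℤ) * n - n)) (topIndex n d r) := by
  have hmonomial : (q ^ (r * (r + n - d * n) / d) : RatFunc ℚ) = ((q ^ r) ^ topIndex n d r)⁻¹ := by
    rw [show r * (r + n - d * n) = d * (-(r * topIndex n d r)) by linear_combination r * hN,
      Int.mul_ediv_cancel_left _ (by positivity), zpow_neg, zpow_mul, zpow_natCast]
  have hbracket (k : ℕ) : qInt (d * n - n) ^ 2 * (2 - q ^ ((d : ℤ) * n - n)) * innerSum d r k =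
      (1 - q ^ ((d : ℤ) * n - n)) ^ 2 * (2 - q ^ ((d : ℤ) * n - n)) *
        (sqHarmonic (q ^ d) (q ^ d) k + sqHarmonic (q ^ r) (q ^ d) k) := by
    have := one_sub_q_ne_zero
    rw [innerSum_eq, qInt]
    generalize sqHarmonic _ _ k + sqHarmonic (q ^ r) _ k = H
    field_simp
  simp only [hbracket, hmonomial, zpow_two_mul, zpow_sub₀ q_ne_zero (d : ℤ) r, zpow_mul q (d : ℤ),
    zpow_natCast]
  rw [balancedSide, qInt]
  change _ * _ * (poch _ _ _ / poch _ _ _) * (∑ k ∈ range _, poch _ _ k ^ 3 * poch _ _ k * _ /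
    (poch _ _ k ^ 3 * poch _ _ k) * _) = _
  ring

end Translation

/-! ### Powers of `Φ_m` in shifted factorials -/

section Counting

theorem div_le_div_sub_add_div {m N k : ℕ} (hm : 0 < m) (hk : k ≤ N) :
    N / m ≤ (N - k) / m + k / m + if N % m < k % m then 1 else 0 := by
  obtain ⟨l, rfl⟩ := Nat.exists_eq_add_of_le' hk
  have hl := Nat.mod_lt l hm
  have hk := Nat.mod_lt k hm
  rw [Nat.add_sub_cancel, Nat.add_div hm, Nat.add_mod l k m]
  split_ifs with hcarry hlt hlt
  · exact le_rfl
  · rw [Nat.mod_eq_sub_mod hcarry, Nat.mod_eq_of_lt (by omega)] at hlt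
    omega
  all_goals omega

variable {m d : ℕ} [NeZero m] (hmd : IsCoprime (m : ℤ) (d : ℤ))
include hmd

theorem exists_lt_dvd_add_mul (s : ℤ) : ∃ i < m, (m : ℤ) ∣ s + d * i := by
  obtain ⟨x, y, hxy⟩ := hmd
  have hm : (m : ℤ) ≠ 0 := mod_cast NeZero.ne m
  refine ⟨(-s * y % m).toNat, ?_, s * x - d * (-s * y / m), ?_⟩
  · have := Int.emod_lt_abs (-s * y) hm
    grind
  · rw [Int.toNat_of_nonneg (Int.emod_nonneg _ hm)]
    linear_combination (-s) * hxy + d * Int.mul_ediv_add_emod (-s * y) m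

theorem cycVal_poch_mul_le (s : ℤ) (l : ℕ) :
    cycVal m (poch (q ^ s) (q ^ d) (l * m)) ≤ unif ^ l := by
  induction l with
  | zero => simp
  | succ l ih =>
    obtain ⟨i, hi, hdvd⟩ := exists_lt_dvd_add_mul hmd (s + d * (l * m : ℕ))
    rw [add_mul, one_mul, poch_add, map_mul, pow_succ, zpow_mul_pow]
    refine mul_le_mul' ih
      (valuation_poch_le_of_factor (cycVal_q_zpow _).le (cycVal_q_pow d).le hi ?_)
    rw [zpow_mul_pow]
    exact cycVal_one_sub_q_zpow_le hdvd

theorem cycVal_poch_le (s : ℤ) (k : ℕ) :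
    cycVal m (poch (q ^ s) (q ^ d) k) ≤ unif ^ (k / m) := by
  conv_lhs => rw [← Nat.div_add_mod' k m, poch_add, map_mul, zpow_mul_pow]
  exact mul_le_of_le_of_le_one (cycVal_poch_mul_le hmd s _)
    (valuation_poch_le_one (cycVal_q_zpow _).le (cycVal_q_pow d).le _)

theorem cycVal_poch_le_of_lt {s : ℤ} {t k : ℕ} (ht : (m : ℤ) ∣ s + d * t) (htk : t < k % m) :
    cycVal m (poch (q ^ s) (q ^ d) k) ≤ unif ^ (k / m + 1) := by
  have hdvd : (m : ℤ) ∣ s + d * (k / m * m : ℕ) + d * t := by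
    rw [add_right_comm]
    exact ht.add ⟨d * (k / m : ℕ), by push_cast; ring⟩
  conv_lhs => rw [← Nat.div_add_mod' k m, poch_add, map_mul, zpow_mul_pow]
  rw [pow_succ]
  refine mul_le_mul' (cycVal_poch_mul_le hmd s _)
    (valuation_poch_le_of_factor (cycVal_q_zpow _).le (cycVal_q_pow d).le htk ?_)
  rw [zpow_mul_pow]
  exact cycVal_one_sub_q_zpow_le hdvd

theorem cycVal_poch_self (hd : 0 < d) (k : ℕ) :
    cycVal m (poch (q ^ d) (q ^ d) k) = unif ^ (k / m) := by
  induction k with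
  | zero => simp
  | succ k ih =>
    have hdvd : (m : ℤ) ∣ d * (k + 1 : ℕ) ↔ m ∣ k + 1 := by
      rw [← Int.natCast_dvd_natCast]
      exact ⟨hmd.dvd_of_dvd_mul_left, fun h => h.mul_left _⟩
    rw [poch_succ, map_mul, ih, pow_mul_pow_eq_zpow, cycVal_one_sub_q_zpow (by positivity),
      Nat.succ_div, pow_add]
    simp only [hdvd]
    split_ifs <;> simp only [pow_one, pow_zero]

theorem cycVal_poch_div_poch_self_le (hd : 0 < d) (s : ℤ) (k : ℕ) :
    cycVal m (poch (q ^ s) (q ^ d) k / poch (q ^ d) (q ^ d) k) ≤ 1 := by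
  rw [map_div₀, cycVal_poch_self hmd hd]
  exact div_le_one_of_le₀ (cycVal_poch_le hmd s k) zero_le

theorem nearRootOfUnity_cycVal {r : ℤ} {s : ℕ} (hs : s < m) (hr : (m : ℤ) ∣ r + d * s) :
    NearRootOfUnity (cycVal m) unif (q ^ r) (q ^ d) m s where
  lt_one := unif_lt_one
  lt := hs
  val_one_sub_pow i hi₀ hi := by
    rw [← pow_mul, ← zpow_natCast, Nat.cast_mul]
    exact cycVal_one_sub_q_zpow_eq_one fun hdvd => Nat.not_dvd_of_pos_of_lt hi₀ hi
      (Int.natCast_dvd_natCast.1 (hmd.dvd_of_dvd_mul_left hdvd))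
  near_p := by
    refine ⟨by rw [← pow_mul, cycVal_q_pow], (map_one _).le, ?_⟩
    rw [← pow_mul, ← zpow_natCast, Valuation.map_sub_swap]
    exact cycVal_one_sub_q_zpow_le ⟨d, by push_cast; ring⟩
  near_a := by
    rw [zpow_mul_pow]
    refine ⟨(cycVal_q_zpow _).le, (map_one _).le, ?_⟩
    rw [Valuation.map_sub_swap]
    exact cycVal_one_sub_q_zpow_le hr

end Counting

/-! ### Congruences at the divisors of `n` -/

section Divisors

theorem add_mul_ne_zero {d : ℕ} {s : ℤ} (hs : ¬ (d : ℤ) ∣ s) (i : ℕ) : s + d * i ≠ 0 := fun h =>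
  hs ⟨-i, by linear_combination h⟩

theorem poch_sq_ne_zero {d : ℕ} {r : ℤ} (hdr : ¬ (d : ℤ) ∣ 2 * r) (k : ℕ) :
    poch ((q ^ r) ^ 2) (q ^ d : RatFunc ℚ) k ≠ 0 := poch_ne_zero_iff.2 fun i _ => by
  rw [← zpow_two_mul, zpow_mul_pow]
  exact one_sub_q_zpow_ne_zero (add_mul_ne_zero hdr i)

theorem cycVal_one_sub_q_inv {m : ℕ} [NeZero m] (hm : 1 < m) : cycVal m (1 - q)⁻¹ = 1 := by
  have hdvd : ¬ (m : ℤ) ∣ 1 := fun h => by have := Int.le_of_dvd one_pos h; omega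
  rw [map_inv₀, ← zpow_one q, cycVal_one_sub_q_zpow_eq_one hdvd, inv_one]

variable {m d N : ℕ} [NeZero m] {r s : ℤ} {u : RatFunc ℚ}

theorem cycVal_sq_mul_sqHarmonic_le (hu : cycVal m (1 - u) ≤ unif) (hs : ∀ i : ℕ, s + d * i ≠ 0)
    (k : ℕ) : cycVal m ((1 - u) ^ 2 * sqHarmonic (q ^ s) (q ^ d) k) ≤ 1 := by
  rw [sqHarmonic, mul_sum]
  refine Valuation.map_sum_le _ fun i _ => ?_
  rw [zpow_mul_pow, map_mul, map_div₀, map_pow, map_pow, cycVal_q_zpow, mul_one_div, ← div_pow]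
  exact pow_le_one' (div_le_one_of_le₀ (hu.trans (unif_le_cycVal_one_sub_q_zpow (hs i))) zero_le) 2

theorem cycVal_bracket_le (hd : 0 < d) (hdr : ¬ (d : ℤ) ∣ r) (hu : cycVal m (1 - u) ≤ unif)
    (k : ℕ) :
    cycVal m (1 - (1 - u) ^ 2 * (2 - u) *
      (sqHarmonic (q ^ d) (q ^ d) k + sqHarmonic (q ^ r) (q ^ d) k)) ≤ 1 := by
  have hself := cycVal_sq_mul_sqHarmonic_le (d := d) (s := d) hu (fun i => by positivity) k
  have hr := cycVal_sq_mul_sqHarmonic_le hu (add_mul_ne_zero hdr) k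
  have htwo : cycVal m (2 - u) ≤ 1 := by
    rw [show 2 - u = 1 + (1 - u) by ring]
    exact Valuation.map_add_le _ (map_one _).le (hu.trans unif_lt_one.le)
  rw [zpow_natCast] at hself
  rw [mul_right_comm, mul_add]
  refine Valuation.map_sub_le _ (map_one _).le ?_
  rw [map_mul]
  exact mul_le_one' (Valuation.map_add_le _ hself hr) htwo

omit [NeZero m] in
theorem dvd_add_mul_mod (hN : (m : ℤ) ∣ r + d * N) : (m : ℤ) ∣ r + d * (N % m : ℕ) := by
  rw [← Nat.mod_add_div N m] at hN
  push_cast at hN ⊢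
  rwa [mul_add, ← add_assoc, mul_left_comm, dvd_add_left (dvd_mul_right _ _)] at hN

variable (hmd : IsCoprime (m : ℤ) (d : ℤ)) (hd : 0 < d) (hN : (m : ℤ) ∣ r + d * N)
include hmd hN

theorem cycVal_poch_mul_poch_le {k : ℕ} (hk : k ≤ N) (s : ℤ) :
    cycVal m (poch (q ^ s) (q ^ d) (N - k) * poch (q ^ r) (q ^ d) k) ≤ unif ^ (N / m) := by
  have hr : cycVal m (poch (q ^ r) (q ^ d) k) ≤
      unif ^ (k / m + if N % m < k % m then 1 else 0) := by
    split_ifs with hlt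
    · exact cycVal_poch_le_of_lt hmd (dvd_add_mul_mod hN) hlt
    · exact cycVal_poch_le hmd r k
  rw [map_mul]
  refine (mul_le_mul' (cycVal_poch_le hmd s (N - k)) hr).trans ?_
  rw [← pow_add, ← add_assoc]
  exact pow_le_pow_right_of_le_one' unif_lt_one.le (div_le_div_sub_add_div (NeZero.pos m) hk)

include hd

theorem cycVal_balancedCoeff_le (hu : cycVal m (1 - u) ≤ unif) {k : ℕ} (hk : k ≤ N) :
    cycVal m (balancedCoeff (q ^ r) (q ^ d) u N k) ≤ unif := by
  have hsplit : balancedCoeff (q ^ r) (q ^ d) u N k =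
      (1 - u) * (((q ^ r) ^ N)⁻¹ * (q ^ d) ^ k) *
        (poch (q ^ (2 * r + d * k)) (q ^ d) (N - k) * poch (q ^ r) (q ^ d) k /
          poch (q ^ d) (q ^ d) N) *
        (poch (q ^ ((d : ℤ) - r)) (q ^ d) k / poch (q ^ d) (q ^ d) k) := by
    rw [balancedCoeff, ← zpow_mul_pow, zpow_two_mul, zpow_sub₀ q_ne_zero, zpow_natCast]
    ring
  rw [hsplit, map_mul, map_mul, map_mul (cycVal m) (1 - u)]
  refine mul_le_of_le_of_le_one (mul_le_of_le_of_le_one (mul_le_of_le_of_le_one hu ?_) ?_)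
    (cycVal_poch_div_poch_self_le hmd hd _ k)
  · simp [cycVal_q]
  · rw [map_div₀, cycVal_poch_self hmd hd]
    exact div_le_one_of_le₀ (cycVal_poch_mul_poch_le hmd hN hk _) zero_le

theorem cycVal_balancedSide_le (hdr : ¬ (d : ℤ) ∣ 2 * r) (hu : cycVal m (1 - u) ≤ unif) :
    cycVal m (balancedSide (q ^ r) (q ^ d) u N) ≤ unif := by
  rw [balancedSide_eq u (poch_sq_ne_zero hdr N)]
  refine Valuation.map_sum_le _ fun k hk => ?_
  rw [map_mul, map_mul, ← div_pow, map_pow]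
  exact mul_le_of_le_of_le_one (cycVal_balancedCoeff_le hmd hd hN hu (mem_range_succ_iff.1 hk))
    (mul_le_one' (pow_le_one' (cycVal_poch_div_poch_self_le hmd hd r k) 2)
      (cycVal_bracket_le hd (fun h => hdr (h.mul_left 2)) hu k))

theorem cycVal_sum_vwpTerm_le {n M : ℕ} (hn : 0 < n) (hmn : m ∣ n) (hM : M = N ∨ M = n - 1) :
    cycVal m (∑ k ∈ range (M + 1), vwpTerm (q ^ r) (q ^ d) k) ≤ unif := by
  have h := nearRootOfUnity_cycVal hmd (Nat.mod_lt N (NeZero.pos m)) (dvd_add_mul_mod hN)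
  have hreg (l : ℕ) := cycVal_poch_div_poch_self_le hmd hd r (l * m)
  rcases hM with rfl | rfl
  · simpa only [← add_assoc, Nat.div_add_mod'] using h.val_sum_vwpTerm_mul_add_le hreg (M / m)
  · simpa only [Nat.div_mul_cancel hmn, Nat.sub_add_cancel hn] using
      h.val_sum_vwpTerm_mul_le hreg (n / m)

end Divisors

section Main

variable {n d : ℕ} {r : ℤ}

theorem mul_topIndex_of_le (hd : 0 < d) (hnd : (d : ℤ) ≤ n + r)
    (hrn : 3 * (n + r) ≤ d * (n + 1)) (hmod : (n : ℤ) ≡ -r [ZMOD d]) :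
    (d : ℤ) * topIndex n d r = d * n - n - r ∧ topIndex n d r < n ∧
      2 * n ≤ 3 * topIndex n d r + 1 := by
  obtain ⟨c, hc⟩ := hmod.symm.dvd
  rw [sub_neg_eq_add] at hc
  have hd₀ : (0 : ℤ) < d := by exact_mod_cast hd
  have hc₁ : 1 ≤ c := le_of_mul_le_mul_left (by rwa [mul_one, ← hc]) hd₀
  have hcn : 3 * c ≤ n + 1 := le_of_mul_le_mul_left (by rwa [mul_left_comm, ← hc]) hd₀
  have hN : (topIndex n d r : ℤ) = n - c := by
    rw [topIndex, show (d : ℤ) * n - n - r = d * (n - c) by linear_combination -hc,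
      Int.mul_ediv_cancel_left _ hd₀.ne', Int.toNat_of_nonneg (by omega)]
  exact ⟨by rw [hN]; linear_combination hc, by omega, by omega⟩

theorem not_dvd_two_mul (hd : 3 ≤ d) (hcop : Nat.gcd n d = 1) (hmod : (n : ℤ) ≡ -r [ZMOD d]) :
    ¬ (d : ℤ) ∣ 2 * r := by
  intro hdvd
  have hdn : (d : ℤ) ∣ 2 * n := by
    have := hmod.symm.dvd
    rw [sub_neg_eq_add] at this
    simpa only [mul_add, add_sub_cancel_right] using (this.mul_left 2).sub hdvd
  have hco : IsCoprime (d : ℤ) (n : ℤ) := (Nat.isCoprime_iff_coprime.2 hcop).symm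
  have := Int.le_of_dvd two_pos (hco.dvd_of_dvd_mul_right hdn)
  omega

theorem cycVal_sum_vwpTerm_sub_balancedSide_le [NeZero n] {N M : ℕ} (hd : 2 ≤ d)
    (hcop : IsCoprime (n : ℤ) (d : ℤ)) (hdr : ¬ (d : ℤ) ∣ 2 * r)
    (hN : (d : ℤ) * N = d * n - n - r) (hNn : N < n) (hnN : 2 * n ≤ 3 * N + 1)
    (hM : M = N ∨ M = n - 1) :
    cycVal n (∑ k ∈ range (M + 1), vwpTerm (q ^ r) (q ^ d) k -
      balancedSide (q ^ r) (q ^ d) (q ^ ((d : ℤ) * n - n)) N) ≤ unif ^ 6 := by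
  have hu : r + (d : ℤ) * N = d * n - n := by linear_combination hN
  have h : NearRootOfUnity (cycVal n) unif (q ^ r) (q ^ d) n N :=
    nearRootOfUnity_cycVal hcop hNn ⟨d - 1, by linear_combination hu⟩
  have hpos : (d : ℤ) * n - n ≠ 0 := by
    rw [← sub_one_mul]
    exact mul_ne_zero (by omega) (by exact_mod_cast NeZero.ne n)
  exact h.val_sum_vwpTerm_sub_balancedSide_le hnN (by rw [zpow_mul_pow, hu])
    (fun hone => one_sub_q_zpow_ne_zero hpos (sub_eq_zero.2 hone.symm)) (poch_sq_ne_zero hdr N)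
    (by omega) (by omega)

end Main

end QSeries

theorem theorem5p2_general (n d : ℕ) (r : ℤ) (hd : 3 ≤ d) (hnd : (d : ℤ) ≤ n + r)
    (hrn : 3 * (n + r) ≤ d * (n + 1)) (hcop : Nat.gcd n d = 1) (hmod : (n : ℤ) ≡ -r [ZMOD d])
    (M : ℕ) (hM : M = topIndex n d r ∨ M = n - 1) :
    RatCongr (modulus n) (lhsSum d r M)
      (qInt (d * n - n) * q ^ (r * (r + n - d * n) / d)
        * (qPoch (q ^ (2 * r)) (q ^ d) (topIndex n d r)
            / qPoch (q ^ d) (q ^ d) (topIndex n d r))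
        * ∑ k ∈ Finset.range (topIndex n d r + 1),
            (qPoch (q ^ r) (q ^ d) k ^ 3 * qPoch (q ^ ((d : ℤ) - r)) (q ^ d) k
                * q ^ ((d : ℤ) * k))
              / (qPoch (q ^ d) (q ^ d) k ^ 3 * qPoch (q ^ (2 * r)) (q ^ d) k)
            * (1 - qInt (d * n - n) ^ 2 * (2 - q ^ ((d : ℤ) * n - n)) * innerSum d r k)) := by
  obtain ⟨hN, hNn, hnN⟩ := mul_topIndex_of_le (by omega) hnd hrn hmod
  have hco : IsCoprime (n : ℤ) (d : ℤ) := Nat.isCoprime_iff_coprime.2 hcop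
  have hdr := not_dvd_two_mul hd hcop hmod
  have hn : 1 < n := by omega
  have : NeZero n := ⟨by omega⟩
  rw [rhs_eq (by omega) hN, lhsSum_eq]
  refine ratCongr_modulus hn ?_ fun m _ hm hmn => ?_
  · rw [← mul_sub, map_mul, cycVal_one_sub_q_inv hn, one_mul]
    exact cycVal_sum_vwpTerm_sub_balancedSide_le (by omega) hco hdr hN hNn hnN hM
  · have hmd := hco.of_isCoprime_of_dvd_left (Int.natCast_dvd_natCast.2 hmn)
    have hmu : (m : ℤ) ∣ d * n - n :=
      .sub ((Int.natCast_dvd_natCast.2 hmn).mul_left _) (Int.natCast_dvd_natCast.2 hmn)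
    have hmN : (m : ℤ) ∣ r + d * topIndex n d r := by
      rwa [show r + (d : ℤ) * topIndex n d r = d * n - n by linear_combination hN]
    rw [← mul_sub, map_mul, cycVal_one_sub_q_inv hm, one_mul]
    exact Valuation.map_sub_le _ (cycVal_sum_vwpTerm_le hmd (by omega) hmN (by omega) hmn hM)
      (cycVal_balancedSide_le hmd (by omega) hmN hdr (cycVal_one_sub_q_zpow_le hmu))

theorem theorem5p2 (n d : ℕ) (r : ℤ) (hr : r = 1 ∨ r = -1)
    (hd : 3 ≤ d) (hnd : (d : ℤ) ≤ n + r) (hcop : Nat.gcd n d = 1)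
    (hmod : (n : ℤ) ≡ -r [ZMOD d])
    (M : ℕ) (hM : M = topIndex n d r ∨ M = n - 1) :
    RatCongr (modulus n) (lhsSum d r M)
      (qInt (d * n - n) * q ^ (r * (r + n - d * n) / d)
        * (qPoch (q ^ (2 * r)) (q ^ d) (topIndex n d r)
            / qPoch (q ^ d) (q ^ d) (topIndex n d r))
        * ∑ k ∈ Finset.range (topIndex n d r + 1),
            (qPoch (q ^ r) (q ^ d) k ^ 3 * qPoch (q ^ ((d : ℤ) - r)) (q ^ d) k
                * q ^ ((d : ℤ) * k))
              / (qPoch (q ^ d) (q ^ d) k ^ 3 * qPoch (q ^ (2 * r)) (q ^ d) k)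
            * (1 - qInt (d * n - n) ^ 2 * (2 - q ^ ((d : ℤ) * n - n)) * innerSum d r k)) :=
  theorem5p2_general n d r hd hnd (by rcases hr with rfl | rfl <;> nlinarith) hcop hmod M hM
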